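/- Let $\hbar>0$ and let $\alpha\neq 0$ be a real number. On the plane with coordinates $(x,y)$, without the singular line $x=0$, let $p_1=-i\hbar\,\partial_x$, $p_2=-i\hbar\,\partial_y$ act on smooth complex-valued functions, let $\{A,B\}=AB+BA$, let $x^{1/3}$ be the real cube root, and set \[ H=\tfrac12(p_1^2+p_2^2)+\frac{\alpha y}{x^{2/3}}-\frac{5\hbar^2}{72x^2}, \] \[ X=3p_1^2p_2+2p_2^3+\Big\{\frac{9\alpha}{2}x^{1/3},\,p_1\Big\}+\Big\{\frac{3\alpha y}{x^{2/3}}-\frac{5\hbar^2}{24x^2},\,p_2\Big\}, \] \[ Y=p_1^4+\Big\{\frac{2\alpha y}{x^{2/3}}-\frac{5\hbar^2}{36x^2},\,p_1^2\Big\}-\big\{6\alpha x^{1/3},\,p_1p_2\big\}-\frac{2\alpha^2(9x^2-2y^2)}{x^{4/3}}-\frac{5\alpha\hbar^2y}{9x^{8/3}}+\frac{25\hbar^4}{1296x^4}. \] Then $X$ and $Y$ are differential operators of order exactly three and four, respectively, and $(H,X,Y)$ is a (maximally) superintegrable quantum system in two dimensions: $[H,X]=[H,Y]=0$, and the three finite-order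 differential operators $H,X,Y$ are algebraically independent, i.e. no nonzero polynomial with complex coefficients vanishes on $(H,X,Y)$ when each of its monomials is evaluated as the symmetrized product (the sum over all orders of the factors). Moreover, the Schrödinger equation $H\Psi=E\Psi$ does not admit multiplicative separation of variables in any system of coordinates. That is, for every nonempty open subset $W$ of $\{x\neq0\}$ and every smooth (real, not necessarily orthogonal) coordinate system $(u,v)$ on $W$, there is no complete separated solution: no family of nowhere vanishing functions $\Psi=A(u;c)\,B(v;c)$ on $W$, with complex-valued $A,B$ depending smoothly on the variable and on four real parameters $c=(c_1,\dots,c_4)$ in a nonempty open set, such that $H\Psi=E(c)\Psi$ for some complex number $E(c)$ and \[ \det\frac{\partial\,(A'/A,\;A''/A,\;B'/B,\;B''/B)}{\partial(c_1,c_2,c_3,c_4)}\neq0 \] at all points of $W$ and all parameters, where primes denote derivatives with respect to $u$ and $v$, respectively. -/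

import Mathlib

open scoped ContDiff
open TopologicalSpace (Opens)

noncomputable section

namespace QuantumPlane

/-! ### Smooth complex functions on an open set of the plane, and operators on them -/

/-- Extension by zero of a function given on an open set of the plane. -/
def extendZero {U : Opens (ℝ × ℝ)} (f : U → ℂ) : ℝ × ℝ → ℂ := by
  classical exact fun z => if h : z ∈ U then f ⟨z, h⟩ else 0

theorem extendZero_of_mem {U : Opens (ℝ × ℝ)} (f : U → ℂ) {z : ℝ × ℝ} (h : z ∈ U) :
    extendZero f z = f ⟨z, h⟩ := by
  simp [extendZero, h]

/-- The algebra `C^∞(U; ℂ)` of smooth complex-valued functions on an open set `U` of the plane.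
(Smoothness on the open set `U` does not see the values of the extension off `U`.) -/
def Smooth (U : Opens (ℝ × ℝ)) : Subalgebra ℂ (U → ℂ) where
  carrier := {f | ContDiffOn ℝ ∞ (extendZero f) U}
  mul_mem' {f g} hf hg := (ContDiffOn.mul hf hg).congr fun z hz => by
    simp [extendZero_of_mem _ (show z ∈ U from hz)]
  add_mem' {f g} hf hg := (ContDiffOn.add hf hg).congr fun z hz => by
    simp [extendZero_of_mem _ (show z ∈ U from hz)]
  algebraMap_mem' c := (contDiffOn_const (c := c)).congr fun z hz => by
    simp [extendZero_of_mem _ (show z ∈ U from hz)]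

/-- The restriction to `U` of a function on the plane that is smooth on `U`. -/
def Smooth.restrict (U : Opens (ℝ × ℝ)) (F : ℝ × ℝ → ℂ) (hF : ContDiffOn ℝ ∞ F U) : Smooth U :=
  ⟨fun z => F z, hF.congr fun _ hz => extendZero_of_mem _ hz⟩

theorem differentiableAt_extendZero {U : Opens (ℝ × ℝ)} (f : Smooth U) (z : U) :
    DifferentiableAt ℝ (extendZero f.1) z :=
  (f.2.contDiffAt (U.isOpen.mem_nhds z.2)).differentiableAt (by simp)

theorem extendZero_add {U : Opens (ℝ × ℝ)} (f g : U → ℂ) :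
    extendZero (f + g) = extendZero f + extendZero g := by
  funext z
  by_cases h : z ∈ U <;> simp [extendZero, h]

theorem extendZero_smul {U : Opens (ℝ × ℝ)} (c : ℂ) (f : U → ℂ) :
    extendZero (c • f) = c • extendZero f := by
  funext z
  by_cases h : z ∈ U <;> simp [extendZero, h]

/-- The derivative in the direction `v`, as a linear operator on `C^∞(U; ℂ)`. -/
def dirDeriv (U : Opens (ℝ × ℝ)) (v : ℝ × ℝ) : Module.End ℂ (Smooth U) where
  toFun f := Smooth.restrict U (fun z => fderiv ℝ (extendZero f.1) z v)
    ((f.2.fderiv_of_isOpen U.isOpen (m := ∞) (by simp)).clm_apply contDiffOn_const)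
  map_add' f g := by
    ext z
    have := fderiv_add (differentiableAt_extendZero f z) (differentiableAt_extendZero g z)
    simp [Smooth.restrict, extendZero_add, this]
  map_smul' c f := by
    ext z
    have := fderiv_const_smul (differentiableAt_extendZero f z) c
    simp [Smooth.restrict, extendZero_smul, this]

/-- `∂/∂x` on `C^∞(U; ℂ)`. -/
def dx (U : Opens (ℝ × ℝ)) : Module.End ℂ (Smooth U) := dirDeriv U (1, 0)

/-- `∂/∂y` on `C^∞(U; ℂ)`. -/
def dy (U : Opens (ℝ × ℝ)) : Module.End ℂ (Smooth U) := dirDeriv U (0, 1)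

/-- The momentum operator `p₁ = -iħ ∂/∂x`. -/
def p1 (U : Opens (ℝ × ℝ)) (ħ : ℝ) : Module.End ℂ (Smooth U) := (-Complex.I * (ħ : ℂ)) • dx U

/-- The momentum operator `p₂ = -iħ ∂/∂y`. -/
def p2 (U : Opens (ℝ × ℝ)) (ħ : ℝ) : Module.End ℂ (Smooth U) := (-Complex.I * (ħ : ℂ)) • dy U

/-- The operator of multiplication by a real function `F` that is smooth on `U`. -/
def mulOp (U : Opens (ℝ × ℝ)) (F : ℝ × ℝ → ℝ) (hF : ContDiffOn ℝ ∞ F U) :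
    Module.End ℂ (Smooth U) :=
  LinearMap.mulLeft ℂ
    (Smooth.restrict U (fun z => (F z : ℂ)) (Complex.ofRealCLM.contDiff.comp_contDiffOn hF))

/-- The Hamiltonian `H = ½ (p₁² + p₂²) + V` on `C^∞(U; ℂ)`. -/
def hamiltonian (U : Opens (ℝ × ℝ)) (ħ : ℝ) (V : ℝ × ℝ → ℝ) (hV : ContDiffOn ℝ ∞ V U) :
    Module.End ℂ (Smooth U) :=
  (1 / 2 : ℂ) • (p1 U ħ ^ 2 + p2 U ħ ^ 2) + mulOp U V hV

/-- The anticommutator `{A, B} = AB + BA`. -/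
def anticomm {R : Type*} [Ring R] (A B : R) : R := A * B + B * A

/-! ### Differential operators and superintegrability -/

/-- Linear partial differential operators on `U` of order at most `n`, with coefficients in
`C^∞(U; ℂ)`: finite sums of `f ∂ₓʲ ∂ᵧᵏ` with `j + k ≤ n`. -/
def diffOps (U : Opens (ℝ × ℝ)) (n : ℕ) : Submodule ℂ (Module.End ℂ (Smooth U)) :=
  Submodule.span ℂ {T | ∃ (f : Smooth U) (j k : ℕ), j + k ≤ n ∧
    T = LinearMap.mulLeft ℂ f * (dx U ^ j * dy U ^ k)}

/-- `L` is a differential operator of order exactly `n`. -/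
def HasOrder {U : Opens (ℝ × ℝ)} (L : Module.End ℂ (Smooth U)) (n : ℕ) : Prop :=
  L ∈ diffOps U n ∧ ∀ m < n, L ∉ diffOps U m

/-- The symmetrized monomial with exponents `m` in the (non-commuting) elements `S i`: the sum of
the products of the `|m|` factors over all `|m|!` orders of the factors. -/
def symmMonomial {ι R : Type*} [Ring R] (S : ι → R) (m : ι →₀ ℕ) : R :=
  ((Finsupp.toMultiset m).lists.map fun l => (l.map S).prod).sum

/-- The value at `S` of the symmetrized polynomial with the coefficients of `P`. -/
def symmEval {ι R : Type*} [Ring R] [Algebra ℂ R] (S : ι → R) (P : MvPolynomial ι ℂ) : R :=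
  ∑ m ∈ P.support, P.coeff m • symmMonomial S m

/-- Algebraic independence of operators: no nonzero symmetrized polynomial vanishes on them. -/
def AlgIndep {ι R : Type*} [Ring R] [Algebra ℂ R] (S : ι → R) : Prop :=
  ∀ P : MvPolynomial ι ℂ, symmEval S P = 0 → P = 0

/-- `L 0 = H, L 1, L 2` form a (maximally) superintegrable quantum system in two dimensions:
they are `2 · 2 - 1 = 3` algebraically independent differential operators of finite order,
and all of them commute with `H`. -/
structure IsSuperintegrable {U : Opens (ℝ × ℝ)} (L : Fin 3 → Module.End ℂ (Smooth U)) :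
    Prop where
  finite_order : ∀ j, ∃ n, L j ∈ diffOps U n
  commute : ∀ j, ⁅L 0, L j⁆ = 0
  algIndep : AlgIndep L

/-! ### Multiplicative separation of variables -/

/-- `φ = (u, v)` is a smooth curvilinear coordinate system on the open set `W`: a smooth
diffeomorphism from `W` onto an open set. -/
structure IsCoordinateSystem (W : Opens (ℝ × ℝ)) (φ : OpenPartialHomeomorph (ℝ × ℝ) (ℝ × ℝ)) :
    Prop where
  source_eq : φ.source = W
  smooth : ContDiffOn ℝ ∞ φ φ.source
  smooth_symm : ContDiffOn ℝ ∞ φ.symm φ.target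

/-- The quantities `A'/A, A''/A, B'/B, B''/B` at the point `(u, v)`, as functions of the
parameters `c`. -/
def logJet (A B : ℝ → (Fin 4 → ℝ) → ℂ) (u v : ℝ) (c : Fin 4 → ℝ) : Fin 4 → ℂ :=
  ![deriv (fun s => A s c) u / A u c, iteratedDeriv 2 (fun s => A s c) u / A u c,
    deriv (fun s => B s c) v / B v c, iteratedDeriv 2 (fun s => B s c) v / B v c]

/-- The Schrödinger equation `H Ψ = E Ψ` with potential `V` admits multiplicative separation of
variables in the coordinates `φ = (u, v)` on `W`: it has a complete separated solution, that is,
a family of nowhere vanishing solutions `Ψ = A(u; c) B(v; c)` with `H Ψ = E(c) Ψ`, depending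
smoothly on `4` parameters `c` (the energy is a function of them), with
`det ∂(A'/A, A''/A, B'/B, B''/B)/∂c ≠ 0`. -/
def SeparatesIn (ħ : ℝ) (V : ℝ × ℝ → ℝ) (W : Opens (ℝ × ℝ)) (hV : ContDiffOn ℝ ∞ V W)
    (φ : OpenPartialHomeomorph (ℝ × ℝ) (ℝ × ℝ)) : Prop :=
  ∃ (C : Set (Fin 4 → ℝ)) (A B : ℝ → (Fin 4 → ℝ) → ℂ) (E : (Fin 4 → ℝ) → ℂ),
    IsOpen C ∧ C.Nonempty ∧
    ContDiffOn ℝ ∞ (fun q : ℝ × (Fin 4 → ℝ) => A q.1 q.2) ((Prod.fst '' φ.target) ×ˢ C) ∧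
    ContDiffOn ℝ ∞ (fun q : ℝ × (Fin 4 → ℝ) => B q.1 q.2) ((Prod.snd '' φ.target) ×ˢ C) ∧
    ∀ c ∈ C,
      (∃ Ψ : Smooth W,
        (∀ z : W, Ψ.1 z = A (φ z).1 c * B (φ z).2 c ∧ Ψ.1 z ≠ 0) ∧
        hamiltonian W ħ V hV Ψ = E c • Ψ) ∧
      ∀ z ∈ W, (Matrix.of fun i j : Fin 4 =>
        fderiv ℝ (fun c' => logJet A B (φ z).1 (φ z).2 c' i) c (Pi.single j 1)).det ≠ 0

/-! ### The system -/

/-- The real cube root `x^{1/3}` of a real number of either sign. -/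
def cbrt (x : ℝ) : ℝ := if 0 ≤ x then x ^ (1 / 3 : ℝ) else -(-x) ^ (1 / 3 : ℝ)

theorem cbrt_ne_zero {x : ℝ} (hx : x ≠ 0) : cbrt x ≠ 0 := by
  unfold cbrt
  split_ifs with h
  · exact (Real.rpow_pos_of_pos (lt_of_le_of_ne h hx.symm) _).ne'
  · exact neg_ne_zero.2 (Real.rpow_pos_of_pos (by linarith) _).ne'

theorem contDiffAt_cbrt {x : ℝ} (hx : x ≠ 0) : ContDiffAt ℝ ∞ cbrt x := by
  rcases lt_or_gt_of_ne hx with h | h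
  · have h1 : ContDiffAt ℝ ∞ (fun x : ℝ => -(-x) ^ (1 / 3 : ℝ)) x :=
      (ContDiffAt.rpow_const_of_ne contDiffAt_id.neg (neg_ne_zero.2 hx)).neg
    refine h1.congr_of_eventuallyEq ?_
    filter_upwards [Iio_mem_nhds h] with y hy
    simp [cbrt, not_le.2 (show y < 0 from hy)]
  · have h1 : ContDiffAt ℝ ∞ (fun x : ℝ => x ^ (1 / 3 : ℝ)) x :=
      ContDiffAt.rpow_const_of_ne contDiffAt_id hx
    refine h1.congr_of_eventuallyEq ?_
    filter_upwards [Ioi_mem_nhds h] with y hy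
    simp [cbrt, le_of_lt (show 0 < y from hy)]

/-- The plane without the singular line `x = 0`. -/
def regularPlane : Opens (ℝ × ℝ) :=
  ⟨{z | z.1 ≠ 0}, isOpen_ne_fun continuous_fst continuous_const⟩

theorem contDiffOn_cbrt_fst :
    ContDiffOn ℝ ∞ (fun z : ℝ × ℝ => cbrt z.1) regularPlane := fun z hz =>
  ((contDiffAt_cbrt (show z.1 ≠ 0 from hz)).comp z contDiffAt_fst).contDiffWithinAt

/-- `a · x^{1/3}` is smooth on the regular plane. -/
theorem smooth_aux1 (a : ℝ) :
    ContDiffOn ℝ ∞ (fun z : ℝ × ℝ => a * cbrt z.1) regularPlane :=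
  contDiffOn_const.mul contDiffOn_cbrt_fst

/-- `a · y / x^{2/3} - b / x²` is smooth on the regular plane. -/
theorem smooth_aux2 (a b k : ℝ) (hk : k ≠ 0) :
    ContDiffOn ℝ ∞ (fun z : ℝ × ℝ => a * z.2 / cbrt z.1 ^ 2 - b / (k * z.1 ^ 2))
      regularPlane := by
  refine ContDiffOn.sub ?_ ?_
  · exact (contDiffOn_const.mul contDiffOn_snd).div (contDiffOn_cbrt_fst.pow 2)
      fun z hz => pow_ne_zero _ (cbrt_ne_zero hz)
  · exact contDiffOn_const.div (contDiffOn_const.mul (contDiffOn_fst.pow 2))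
      fun z hz => mul_ne_zero hk (pow_ne_zero _ hz)

/-- The potential `V = α y / x^{2/3} - 5ħ² / (72 x²)`. -/
def potential (ħ α : ℝ) (z : ℝ × ℝ) : ℝ :=
  α * z.2 / cbrt z.1 ^ 2 - 5 * ħ ^ 2 / (72 * z.1 ^ 2)

theorem smooth_potential (ħ α : ℝ) : ContDiffOn ℝ ∞ (potential ħ α) regularPlane :=
  smooth_aux2 α (5 * ħ ^ 2) 72 (by norm_num)

/-- `H = ½ (p₁² + p₂²) + α y / x^{2/3} - 5ħ² / (72 x²)`. -/
def opH (ħ α : ℝ) : Module.End ℂ (Smooth regularPlane) :=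
  hamiltonian regularPlane ħ (potential ħ α) (smooth_potential ħ α)

/-- `X = 3 p₁² p₂ + 2 p₂³ + {(9α/2) x^{1/3}, p₁} + {3αy/x^{2/3} - 5ħ²/(24x²), p₂}`. -/
def opX (ħ α : ℝ) : Module.End ℂ (Smooth regularPlane) :=
  let P := p1 regularPlane ħ
  let Q := p2 regularPlane ħ
  (3 : ℂ) • (P ^ 2 * Q) + (2 : ℂ) • Q ^ 3
    + anticomm (mulOp regularPlane (fun z => 9 * α / 2 * cbrt z.1) (smooth_aux1 _)) P
    + anticomm (mulOp regularPlane
        (fun z => 3 * α * z.2 / cbrt z.1 ^ 2 - 5 * ħ ^ 2 / (24 * z.1 ^ 2))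
        (smooth_aux2 _ _ _ (by norm_num))) Q

/-- The function
`-2α²(9x² - 2y²)/x^{4/3} - 5αħ² y/(9 x^{8/3}) + 25ħ⁴/(1296 x⁴)`. -/
def scalarY (ħ α : ℝ) (z : ℝ × ℝ) : ℝ :=
  -(2 * α ^ 2 * (9 * z.1 ^ 2 - 2 * z.2 ^ 2) / cbrt z.1 ^ 4)
    - 5 * α * ħ ^ 2 * z.2 / (9 * cbrt z.1 ^ 8) + 25 * ħ ^ 4 / (1296 * z.1 ^ 4)

theorem smooth_scalarY (ħ α : ℝ) : ContDiffOn ℝ ∞ (scalarY ħ α) regularPlane := by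
  refine ContDiffOn.add (ContDiffOn.sub (ContDiffOn.neg ?_) ?_) ?_
  · exact (contDiffOn_const.mul ((contDiffOn_const.mul (contDiffOn_fst.pow 2)).sub
      (contDiffOn_const.mul (contDiffOn_snd.pow 2)))).div (contDiffOn_cbrt_fst.pow 4)
      fun z hz => pow_ne_zero _ (cbrt_ne_zero hz)
  · exact (contDiffOn_const.mul contDiffOn_snd).div
      (contDiffOn_const.mul (contDiffOn_cbrt_fst.pow 8))
      fun z hz => mul_ne_zero (by norm_num) (pow_ne_zero _ (cbrt_ne_zero hz))
  · exact contDiffOn_const.div (contDiffOn_const.mul (contDiffOn_fst.pow 4))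
      fun z hz => mul_ne_zero (by norm_num) (pow_ne_zero _ hz)

/-- `Y = p₁⁴ + {2αy/x^{2/3} - 5ħ²/(36x²), p₁²} - {6αx^{1/3}, p₁p₂}
- 2α²(9x² - 2y²)/x^{4/3} - 5αħ²y/(9x^{8/3}) + 25ħ⁴/(1296x⁴)`. -/
def opY (ħ α : ℝ) : Module.End ℂ (Smooth regularPlane) :=
  let P := p1 regularPlane ħ
  let Q := p2 regularPlane ħ
  P ^ 4
    + anticomm (mulOp regularPlane
        (fun z => 2 * α * z.2 / cbrt z.1 ^ 2 - 5 * ħ ^ 2 / (36 * z.1 ^ 2))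
        (smooth_aux2 _ _ _ (by norm_num))) (P ^ 2)
    - anticomm (mulOp regularPlane (fun z => 6 * α * cbrt z.1) (smooth_aux1 _)) (P * Q)
    + mulOp regularPlane (scalarY ħ α) (smooth_scalarY ħ α)

end QuantumPlane

end

/-! Write k = -iħ. The relations [H, X] = [H, Y] = 0 and [X, Y] = -108 k α³ are finite computations:
in terms of t = x^{1/3}, w = t⁻¹ and y all coefficients are polynomials, and ∂ₓ, ∂ᵧ act on them by
explicit rules (`formH_formX_comm`, `formH_formY_comm`, `formX_formY_comm`). The exact orders follow
because a commutator with a multiplication operator lowers the order by one, while the third such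
commutator of X with y and the fourth of Y with x are nonzero constants.

Independence rests on X and Y forming a Heisenberg pair over the commuting element H. A commutator
with Y deletes one factor X from a word, and a commutator with X deletes one factor Y, up to
constants. Enough commutators turn a vanishing symmetrized polynomial into a polynomial in H alone.
But H is transcendental: ∂ᵧⁿHⁿ1 = n! (α x^{-2/3})ⁿ, and further ∂ᵧ-derivatives vanish.

For nonseparability, divide HΨ = EΨ by Ψ = AB. This gives a relation between a₁ = A'/A, a₂ = A''/A,
b₁ = B'/B, b₂ = B''/B whose coefficients are P = |∇u|², R = ∇u·∇v, Q = |∇v|², Δu, Δv and V.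
Eliminating the third derivatives from its u-, v- and uv-derivatives leaves a polynomial in (a₁, a₂,
b₁, b₂). At a fixed point the Jacobian condition on the parameters makes all its coefficients
vanish. Hence R = 0, and P, Q, V satisfy the Stäckel conditions (log P)_{uv} = (log Q)_{uv} = (log
P)_v (log Q)_u, V_{uv} = (log P)_v V_u + (log Q)_u V_v.

On a ball these are the integrability conditions for a Killing tensor K with eigendirections ∇u, ∇v
and eigenvalues differing by a nowhere vanishing δ, and they make K dV closed
(`isKilling_of_stackel`, `bertrandDarboux_of_stackel`). A planar Killing tensor is an explicit
quadratic polynomial, and closedness of K dV for this potential forces K to be a multiple of the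
identity (`bertrandDarboux_rigid`). This contradicts δ ≠ 0. -/

noncomputable section
namespace QuantumPlane

/-! ### Smooth functions as a differential algebra; closed forms on convex sets -/

namespace Smooth

variable {U : Opens (ℝ × ℝ)}

theorem ext_apply {f g : Smooth U} (h : ∀ z : U, f.1 z = g.1 z) : f = g :=
  Subtype.ext (funext h)

@[simp] theorem coe_restrict (F : ℝ × ℝ → ℂ) (hF : ContDiffOn ℝ ∞ F U) (z : U) :
    (restrict U F hF).1 z = F z := rfl

theorem extendZero_restrict_eventuallyEq (F : ℝ × ℝ → ℂ) (hF : ContDiffOn ℝ ∞ F U) (z : U) :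
    extendZero (restrict U F hF).1 =ᶠ[nhds z.1] F := by
  filter_upwards [U.isOpen.mem_nhds z.2] with y hy
  exact extendZero_of_mem _ hy

theorem coe_dirDeriv (v : ℝ × ℝ) (f : Smooth U) (z : U) :
    (dirDeriv U v f).1 z = fderiv ℝ (extendZero f.1) z v := rfl

theorem dirDeriv_restrict (v : ℝ × ℝ) (F : ℝ × ℝ → ℂ) (hF : ContDiffOn ℝ ∞ F U) (z : U) :
    (dirDeriv U v (restrict U F hF)).1 z = fderiv ℝ F z v := by
  rw [coe_dirDeriv, (extendZero_restrict_eventuallyEq F hF z).fderiv_eq]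

theorem extendZero_mul (f g : U → ℂ) : extendZero (f * g) = extendZero f * extendZero g := by
  funext z
  by_cases h : z ∈ U <;> simp [extendZero, h]

theorem dirDeriv_mul (v : ℝ × ℝ) (f g : Smooth U) :
    dirDeriv U v (f * g) = f * dirDeriv U v g + g * dirDeriv U v f := by
  refine ext_apply fun z => ?_
  have h := fderiv_mul (differentiableAt_extendZero f z) (differentiableAt_extendZero g z)
  have h2 : (dirDeriv U v (f * g)).1 z
      = fderiv ℝ (extendZero f.1 * extendZero g.1) z v := by
    rw [coe_dirDeriv, ← extendZero_mul]; rfl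
  rw [h2, h]
  simp [coe_dirDeriv, extendZero_of_mem _ z.2]

/-- The directional derivative as a derivation of the algebra of smooth functions. -/
def derivation (U : Opens (ℝ × ℝ)) (v : ℝ × ℝ) : Derivation ℂ (Smooth U) (Smooth U) :=
  Derivation.mk' (dirDeriv U v) fun f g => by
    simpa [smul_eq_mul] using dirDeriv_mul v f g

theorem dirDeriv_eq_derivation (v : ℝ × ℝ) (f : Smooth U) :
    dirDeriv U v f = derivation U v f := rfl

/-- `∂/∂x` as a derivation. -/
abbrev Dx (U : Opens (ℝ × ℝ)) : Derivation ℂ (Smooth U) (Smooth U) := derivation U (1, 0)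

/-- `∂/∂y` as a derivation. -/
abbrev Dy (U : Opens (ℝ × ℝ)) : Derivation ℂ (Smooth U) (Smooth U) := derivation U (0, 1)

theorem dx_apply (f : Smooth U) : dx U f = Dx U f := rfl

theorem dy_apply (f : Smooth U) : dy U f = Dy U f := rfl

theorem derivation_comm (v w : ℝ × ℝ) (f : Smooth U) :
    derivation U v (derivation U w f) = derivation U w (derivation U v f) := by
  have key : ∀ (v w : ℝ × ℝ) (z : U), (derivation U v (derivation U w f)).1 z
      = fderiv ℝ (fderiv ℝ (extendZero f.1)) z v w := by
    intro v w z
    have hd : DifferentiableAt ℝ (fderiv ℝ (extendZero f.1)) z.1 := by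
      have := (f.2.contDiffAt (U.isOpen.mem_nhds z.2)).fderiv_right (m := ∞) (by simp)
      exact this.differentiableAt (by simp)
    have h1 : (derivation U v (derivation U w f)).1 z
        = fderiv ℝ (fun z => fderiv ℝ (extendZero f.1) z w) z v :=
      dirDeriv_restrict v _ _ z
    rw [h1, fderiv_clm_apply hd (differentiableAt_const w)]
    simp
  refine ext_apply fun z => ?_
  rw [key, key]
  exact ((f.2.contDiffAt (U.isOpen.mem_nhds z.2)).isSymmSndFDerivAt
    (by simp only [minSmoothness_of_isRCLikeNormedField]; exact WithTop.coe_le_coe.2 le_top)) v w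

theorem Dx_Dy (f : Smooth U) : Dx U (Dy U f) = Dy U (Dx U f) := derivation_comm _ _ f

/-- A real function that is smooth on `U`, as an element of the algebra of smooth functions. -/
def ofReal (U : Opens (ℝ × ℝ)) (F : ℝ × ℝ → ℝ) (hF : ContDiffOn ℝ ∞ F U) : Smooth U :=
  restrict U (fun z => (F z : ℂ)) (Complex.ofRealCLM.contDiff.comp_contDiffOn hF)

theorem derivation_ofReal (v : ℝ × ℝ) (F : ℝ × ℝ → ℝ) (hF : ContDiffOn ℝ ∞ F U) (z : U)
    {F' : ℝ × ℝ →L[ℝ] ℝ} (h : HasFDerivAt F F' z) :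
    (derivation U v (ofReal U F hF)).1 z = (F' v : ℂ) := by
  have h2 : HasFDerivAt (fun z => (F z : ℂ)) (Complex.ofRealCLM.comp F') z.1 :=
    Complex.ofRealCLM.hasFDerivAt.comp z.1 h
  refine (dirDeriv_restrict v _ _ z).trans ?_
  rw [h2.fderiv]
  rfl

/-- The coordinate `x` as a smooth function. -/
def coordX (U : Opens (ℝ × ℝ)) : Smooth U := ofReal U Prod.fst contDiffOn_fst

/-- The coordinate `y` as a smooth function. -/
def coordY (U : Opens (ℝ × ℝ)) : Smooth U := ofReal U Prod.snd contDiffOn_snd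

@[simp] theorem Dx_coordX : Dx U (coordX U) = 1 :=
  ext_apply fun z => by
    rw [coordX, derivation_ofReal _ _ _ z hasFDerivAt_fst]; simp

@[simp] theorem Dy_coordX : Dy U (coordX U) = 0 :=
  ext_apply fun z => by
    rw [coordX, derivation_ofReal _ _ _ z hasFDerivAt_fst]; simp

@[simp] theorem Dx_coordY : Dx U (coordY U) = 0 :=
  ext_apply fun z => by
    rw [coordY, derivation_ofReal _ _ _ z hasFDerivAt_snd]; simp

@[simp] theorem Dy_coordY : Dy U (coordY U) = 1 :=
  ext_apply fun z => by
    rw [coordY, derivation_ofReal _ _ _ z hasFDerivAt_snd]; simp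

theorem exists_mul_eq_one (f : Smooth U) (hf : ∀ z, f.1 z ≠ 0) : ∃ g : Smooth U, f * g = 1 := by
  have h : ContDiffOn ℝ ∞ (fun z => (extendZero f.1 z)⁻¹) U :=
    f.2.inv fun z hz => by rw [extendZero_of_mem _ hz]; exact hf _
  refine ⟨restrict U _ h, ext_apply fun z => ?_⟩
  simp [extendZero_of_mem _ z.2, hf z]

theorem eq_algebraMap_of_convex (hU : Convex ℝ (U : Set (ℝ × ℝ))) (f : Smooth U)
    (hx : Dx U f = 0) (hy : Dy U f = 0) : ∃ c : ℂ, f = algebraMap ℂ _ c := by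
  by_cases hne : Nonempty U
  · obtain ⟨z₀⟩ := hne
    refine ⟨f.1 z₀, ext_apply fun z => ?_⟩
    have hz : ∀ z ∈ (U : Set (ℝ × ℝ)), fderivWithin ℝ (extendZero f.1) U z = 0 := by
      intro z hz
      rw [fderivWithin_of_isOpen U.isOpen hz]
      ext
      · have : (Dx U f).1 ⟨z, hz⟩ = 0 := by rw [hx]; rfl
        simpa [← dirDeriv_eq_derivation, coe_dirDeriv] using this
      · have : (Dy U f).1 ⟨z, hz⟩ = 0 := by rw [hy]; rfl
        simpa [← dirDeriv_eq_derivation, coe_dirDeriv] using this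
    have := hU.is_const_of_fderivWithin_eq_zero (f.2.differentiableOn (by simp)) hz z.2 z₀.2
    rw [extendZero_of_mem _ z.2, extendZero_of_mem _ z₀.2] at this
    simpa [Algebra.algebraMap_eq_smul_one] using this
  · exact ⟨0, ext_apply fun z => (hne ⟨z⟩).elim⟩

/-- Poincaré lemma: a closed smooth `1`-form on a convex open set is exact. -/
theorem exists_primitive_of_convex (hU : Convex ℝ (U : Set (ℝ × ℝ))) (f g : Smooth U)
    (h : Dy U f = Dx U g) : ∃ F : Smooth U, Dx U F = f ∧ Dy U F = g := by
  let cx : ℂ →L[ℝ] (ℝ × ℝ →L[ℝ] ℂ) :=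
    ContinuousLinearMap.smulRightL ℝ (ℝ × ℝ) ℂ (ContinuousLinearMap.fst ℝ ℝ ℝ)
  let cy : ℂ →L[ℝ] (ℝ × ℝ →L[ℝ] ℂ) :=
    ContinuousLinearMap.smulRightL ℝ (ℝ × ℝ) ℂ (ContinuousLinearMap.snd ℝ ℝ ℝ)
  let η : ℝ × ℝ → (ℝ × ℝ →L[ℝ] ℂ) := fun z => cx (extendZero f.1 z) + cy (extendZero g.1 z)
  have hηs : ContDiffOn ℝ ∞ η U :=
    (cx.contDiff.comp_contDiffOn f.2).add (cy.contDiff.comp_contDiffOn g.2)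
  have hη : ∀ z : U, HasFDerivAt η (cx.comp (fderiv ℝ (extendZero f.1) z)
      + cy.comp (fderiv ℝ (extendZero g.1) z)) z := fun z =>
    (cx.hasFDerivAt.comp z.1 (differentiableAt_extendZero f z).hasFDerivAt).add
      (cy.hasFDerivAt.comp z.1 (differentiableAt_extendZero g z).hasFDerivAt)
  have hd : DifferentiableOn ℝ η U := ContDiffOn.differentiableOn hηs (by simp)
  obtain ⟨F, hF⟩ := hU.exists_forall_hasFDerivAt_of_fderiv_symmetric U.isOpen hd (by

      intro a ha x y
      have h1 : fderiv ℝ (extendZero f.1) a (0, 1) = fderiv ℝ (extendZero g.1) a (1, 0) :=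
        congrArg (fun k : Smooth U => k.1 ⟨a, ha⟩) h
      have hd : ∀ (k : ℝ × ℝ → ℂ) (v : ℝ × ℝ), fderiv ℝ k a v
          = v.1 * fderiv ℝ k a (1, 0) + v.2 * fderiv ℝ k a (0, 1) := by
        intro k v
        have hv : v = v.1 • ((1, 0) : ℝ × ℝ) + v.2 • ((0, 1) : ℝ × ℝ) := by ext <;> simp
        conv_lhs => rw [hv, map_add, map_smul, map_smul]
        simp
      rw [(hη ⟨a, ha⟩).fderiv]
      simp only [add_apply, ContinuousLinearMap.comp_apply, cx, cy,
        ContinuousLinearMap.smulRightL_apply_apply, ContinuousLinearMap.smulRight_apply,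
        ContinuousLinearMap.coe_fst', ContinuousLinearMap.coe_snd', Complex.real_smul]
      rw [hd (extendZero f.1) x, hd (extendZero f.1) y, hd (extendZero g.1) x,
        hd (extendZero g.1) y, h1]
      ring)
  have hFs : ContDiffOn ℝ ∞ F U := by
    rw [contDiffOn_infty_iff_fderiv_of_isOpen U.isOpen]
    exact ⟨fun z hz => (hF z hz).differentiableAt.differentiableWithinAt,
      hηs.congr fun z hz => (hF z hz).fderiv⟩
  refine ⟨restrict U F hFs, ext_apply fun z => ?_, ext_apply fun z => ?_⟩
  · rw [← dirDeriv_eq_derivation, dirDeriv_restrict, (hF z z.2).fderiv]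
    simp [η, cx, cy, extendZero_of_mem _ z.2]
  · rw [← dirDeriv_eq_derivation, dirDeriv_restrict, (hF z z.2).fderiv]
    simp [η, cx, cy, extendZero_of_mem _ z.2]

/-- The exponential of a smooth function. -/
theorem exists_exp (f : Smooth U) : ∃ g : Smooth U, (∀ z, g.1 z ≠ 0) ∧
    ∀ v, derivation U v g = g * derivation U v f := by
  have h : ContDiffOn ℝ ∞ (fun z => Complex.exp (extendZero f.1 z)) U := f.2.cexp
  refine ⟨restrict U _ h, fun z => Complex.exp_ne_zero _, fun v => ext_apply fun z => ?_⟩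
  rw [← dirDeriv_eq_derivation, dirDeriv_restrict,
    ((differentiableAt_extendZero f z).hasFDerivAt.cexp).fderiv]
  simp [← dirDeriv_eq_derivation, coe_dirDeriv]

end Smooth

end QuantumPlane
end

/-! ### Commutation relations in an abstract differential algebra -/

noncomputable section
namespace QuantumPlane
section
variable {S : Type*} [CommRing S] [Algebra ℂ S] (X Y : Derivation ℂ S S)

/-- Here k stands for -iħ, so that -ħ² = k², and t, w stand for x^{1/3}, x^{-1/3}. Every coefficient
of the three operators becomes a polynomial in t, w, y, and `X`, `Y` play the roles of ∂ₓ, ∂ᵧ. -/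
def formH (k a : ℂ) (w y f : S) : S :=
  (k ^ 2 / 2) • (X (X f) + Y (Y f)) + (a • (y * w ^ 2) + (5 * k ^ 2 / 72) • w ^ 6) * f

def formX (k a : ℂ) (t w y f : S) : S :=
  (3 * k ^ 3) • X (X (Y f)) + (2 * k ^ 3) • Y (Y (Y f))
    + (9 * a / 2 * k) • (t * X f + X (t * f))
    + k • ((3 * a) • (y * w ^ 2 * Y f + Y (y * w ^ 2 * f))
      + (5 * k ^ 2 / 24) • (w ^ 6 * Y f + Y (w ^ 6 * f)))

def formY (k a : ℂ) (t w y f : S) : S :=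
  k ^ 4 • X (X (X (X f)))
    + k ^ 2 • ((2 * a) • (y * w ^ 2 * X (X f) + X (X (y * w ^ 2 * f)))
      + (5 * k ^ 2 / 36) • (w ^ 6 * X (X f) + X (X (w ^ 6 * f))))
    - (6 * a * k ^ 2) • (t * X (Y f) + X (Y (t * f)))
    + ((-18 * a ^ 2) • t ^ 2 + (4 * a ^ 2) • (y ^ 2 * w ^ 4) + (5 * a * k ^ 2 / 9) • (y * w ^ 8)
      + (25 * k ^ 4 / 1296) • w ^ 12) * f

variable {X Y}

-- The Leibniz rule expands both sides into coefficients times iterated derivatives of f, and `hXY`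
-- moves every `Y` outside to give mixed derivatives a normal form. The character `e` transports the
-- identity to the field ℂ, where w is literally the inverse of t and the values of the derivatives
-- of f are independent atoms.
set_option linter.unusedSimpArgs false in
set_option maxHeartbeats 4000000 in
theorem formH_formX_comm
    {t w y : S} (hXY : ∀ f, X (Y f) = Y (X f)) (htw : t * w = 1)
    (hXt : X t = (1 / 3 : ℂ) • w ^ 2) (hXw : X w = (-1 / 3 : ℂ) • w ^ 4) (hYt : Y t = 0)
    (hYw : Y w = 0) (hXy : X y = 0) (hYy : Y y = 1) (k a : ℂ) (f : S) (e : S →ₐ[ℂ] ℂ) :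
    e (formH X Y k a w y (formX X Y k a t w y f))
      = e (formX X Y k a t w y (formH X Y k a w y f)) := by
  have he : e w = (e t)⁻¹ := by
    apply eq_inv_of_mul_eq_one_right
    rw [← map_mul, htw, map_one]
  have h0 : e t ≠ 0 := by
    intro h; have := congrArg e htw; simp [h] at this
  have h01 (D : Derivation ℂ S S) : D 0 = 0 := D.map_zero
  have h02 (D : Derivation ℂ S S) : D 1 = 0 := D.map_one_eq_zero
  have hn (D : Derivation ℂ S S) (n : ℕ) [n.AtLeastTwo] : D (OfNat.ofNat n : S) = 0 :=
    D.map_natCast n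
  simp only [formH, formX, formY, hn, h01, h02, Nat.cast_zero, Nat.cast_one, pow_zero, pow_one,
    Nat.cast_ofNat, Nat.reduceSub, map_ofNat, map_add, map_sub, map_smul, Derivation.map_smul,
    Derivation.leibniz, Derivation.leibniz_pow, hXt, hXw, hYt, hYw, hXy, hYy, hXY, smul_eq_mul,
    map_mul, map_pow, map_zero, map_one, he, Derivation.map_one_eq_zero, smul_zero, mul_zero,
    add_zero, zero_add, map_nsmul, nsmul_eq_mul, smul_add, map_natCast]
  field_simp
  ring

set_option linter.unusedSimpArgs false in
set_option maxHeartbeats 4000000 in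
theorem formH_formY_comm
    {t w y : S} (hXY : ∀ f, X (Y f) = Y (X f)) (htw : t * w = 1)
    (hXt : X t = (1 / 3 : ℂ) • w ^ 2) (hXw : X w = (-1 / 3 : ℂ) • w ^ 4) (hYt : Y t = 0)
    (hYw : Y w = 0) (hXy : X y = 0) (hYy : Y y = 1) (k a : ℂ) (f : S) (e : S →ₐ[ℂ] ℂ) :
    e (formH X Y k a w y (formY X Y k a t w y f))
      = e (formY X Y k a t w y (formH X Y k a w y f)) := by
  have he : e w = (e t)⁻¹ := by
    apply eq_inv_of_mul_eq_one_right
    rw [← map_mul, htw, map_one]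
  have h0 : e t ≠ 0 := by
    intro h; have := congrArg e htw; simp [h] at this
  have h01 (D : Derivation ℂ S S) : D 0 = 0 := D.map_zero
  have h02 (D : Derivation ℂ S S) : D 1 = 0 := D.map_one_eq_zero
  have hn (D : Derivation ℂ S S) (n : ℕ) [n.AtLeastTwo] : D (OfNat.ofNat n : S) = 0 :=
    D.map_natCast n
  simp only [formH, formX, formY, hn, h01, h02, Nat.cast_zero, Nat.cast_one, pow_zero, pow_one,
    Nat.cast_ofNat, Nat.reduceSub, map_ofNat, map_add, map_sub, map_smul, Derivation.map_smul,
    Derivation.leibniz, Derivation.leibniz_pow, hXt, hXw, hYt, hYw, hXy, hYy, hXY, smul_eq_mul,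
    map_mul, map_pow, map_zero, map_one, he, Derivation.map_one_eq_zero, smul_zero, mul_zero,
    add_zero, zero_add, map_nsmul, nsmul_eq_mul, smul_add, map_natCast]
  field_simp
  ring

-- All derivatives of f cancel and a central constant remains. It is nonzero for k, a ≠ 0, which
-- makes the two operators a Heisenberg pair.
set_option linter.unusedSimpArgs false in
set_option maxHeartbeats 4000000 in
theorem formX_formY_comm
    {t w y : S} (hXY : ∀ f, X (Y f) = Y (X f)) (htw : t * w = 1)
    (hXt : X t = (1 / 3 : ℂ) • w ^ 2) (hXw : X w = (-1 / 3 : ℂ) • w ^ 4) (hYt : Y t = 0)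
    (hYw : Y w = 0) (hXy : X y = 0) (hYy : Y y = 1) (k a : ℂ) (f : S) (e : S →ₐ[ℂ] ℂ) :
    e (formX X Y k a t w y (formY X Y k a t w y f))
      = e (formY X Y k a t w y (formX X Y k a t w y f))
      + e ((-108 * k * a ^ 3) • f) := by
  have he : e w = (e t)⁻¹ := by
    apply eq_inv_of_mul_eq_one_right
    rw [← map_mul, htw, map_one]
  have h0 : e t ≠ 0 := by
    intro h; have := congrArg e htw; simp [h] at this
  have h01 (D : Derivation ℂ S S) : D 0 = 0 := D.map_zero
  have h02 (D : Derivation ℂ S S) : D 1 = 0 := D.map_one_eq_zero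
  have hn (D : Derivation ℂ S S) (n : ℕ) [n.AtLeastTwo] : D (OfNat.ofNat n : S) = 0 :=
    D.map_natCast n
  simp only [formH, formX, formY, hn, h01, h02, Nat.cast_zero, Nat.cast_one, pow_zero, pow_one,
    Nat.cast_ofNat, Nat.reduceSub, map_ofNat, map_add, map_sub, map_smul, Derivation.map_smul,
    Derivation.leibniz, Derivation.leibniz_pow, hXt, hXw, hYt, hYw, hXy, hYy, hXY, smul_eq_mul,
    map_mul, map_pow, map_zero, map_one, he, Derivation.map_one_eq_zero, smul_zero, mul_zero,
    add_zero, zero_add, map_nsmul, nsmul_eq_mul, smul_add, map_natCast]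
  field_simp
  ring

end
end QuantumPlane
end

/-! ### The real cube root, and the operators as instances of the algebraic model -/

noncomputable section
namespace QuantumPlane

theorem cbrt_pow_three (x : ℝ) : cbrt x ^ 3 = x := by
  unfold cbrt
  split_ifs with h
  · rw [← Real.rpow_natCast, ← Real.rpow_mul h]; norm_num
  · have h' : 0 ≤ -x := by linarith
    have : ((-x) ^ (1 / 3 : ℝ)) ^ 3 = -x := by
      rw [← Real.rpow_natCast, ← Real.rpow_mul h']; norm_num
    linear_combination -this

namespace Smooth

variable {U : Opens (ℝ × ℝ)}

/-- Evaluation at a point. -/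
def eval (z : U) : Smooth U →ₐ[ℂ] ℂ := (Pi.evalAlgHom ℂ (fun _ : U => ℂ) z).comp (Smooth U).val

theorem eval_apply (z : U) (f : Smooth U) : eval z f = f.1 z := rfl

theorem ext_eval {f g : Smooth U} (h : ∀ z : U, eval z f = eval z g) : f = g := ext_apply h

end Smooth

open Smooth

variable {U : Opens (ℝ × ℝ)}

theorem contDiffOn_cbrt_fst_mono (hU : U ≤ regularPlane) :
    ContDiffOn ℝ ∞ (fun z : ℝ × ℝ => cbrt z.1) U := contDiffOn_cbrt_fst.mono hU

/-- `x^{1/3}` as a smooth function. -/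
def cbrtX (hU : U ≤ regularPlane) : Smooth U :=
  ofReal U (fun z => cbrt z.1) (contDiffOn_cbrt_fst_mono hU)

/-- `x^{-1/3}` as a smooth function. -/
def invCbrtX (hU : U ≤ regularPlane) : Smooth U :=
  ofReal U (fun z => (cbrt z.1)⁻¹)
    ((contDiffOn_cbrt_fst_mono hU).inv fun _ hz => cbrt_ne_zero (hU hz))

variable (hU : U ≤ regularPlane)

@[simp] theorem eval_cbrtX (z : U) : eval z (cbrtX hU) = cbrt z.1.1 := rfl

@[simp] theorem eval_invCbrtX (z : U) : eval z (invCbrtX hU) = (cbrt z.1.1 : ℂ)⁻¹ :=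
  Complex.ofReal_inv _

@[simp] theorem eval_coordX (z : U) : eval z (coordX U) = z.1.1 := rfl

@[simp] theorem eval_coordY (z : U) : eval z (coordY U) = z.1.2 := rfl

theorem cbrtX_mul_invCbrtX : cbrtX hU * invCbrtX hU = 1 := by
  refine ext_eval fun z => ?_
  have h : (cbrt z.1.1 : ℂ) ≠ 0 := Complex.ofReal_ne_zero.2 (cbrt_ne_zero (hU z.2))
  simp [h]

theorem cbrtX_pow_three : cbrtX hU ^ 3 = coordX U := by
  refine ext_eval fun z => ?_
  rw [map_pow, eval_cbrtX, eval_coordX]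
  exact_mod_cast cbrt_pow_three _

/-- Implicit differentiation of t³ = x. This treats both signs of x at once, with no derivative of a
real power. -/
theorem three_smul_derivation_cbrtX (D : Derivation ℂ (Smooth U) (Smooth U)) :
    (3 : ℂ) • D (cbrtX hU) = invCbrtX hU ^ 2 * D (coordX U) := by
  rw [← cbrtX_pow_three hU, Derivation.leibniz_pow]
  refine ext_eval fun z => ?_
  have h : (cbrt z.1.1 : ℂ) ≠ 0 := Complex.ofReal_ne_zero.2 (cbrt_ne_zero (hU z.2))
  have h3 : eval z (3 : Smooth U) = 3 := map_ofNat _ 3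
  simp [h3]
  field_simp

theorem Dx_cbrtX : Dx U (cbrtX hU) = (1 / 3 : ℂ) • invCbrtX hU ^ 2 := by
  have := three_smul_derivation_cbrtX hU (Dx U)
  rw [Dx_coordX, mul_one] at this
  rw [← this, smul_smul]; norm_num

theorem Dy_cbrtX : Dy U (cbrtX hU) = 0 := by
  have := three_smul_derivation_cbrtX hU (Dy U)
  rw [Dy_coordX, mul_zero] at this
  exact (smul_eq_zero.1 this).resolve_left (by norm_num)

theorem derivation_invCbrtX (D : Derivation ℂ (Smooth U) (Smooth U)) :
    D (invCbrtX hU) = -invCbrtX hU ^ 2 * D (cbrtX hU) := by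
  have h := congrArg D (cbrtX_mul_invCbrtX hU)
  simp only [Derivation.leibniz, Derivation.map_one_eq_zero, smul_eq_mul] at h
  linear_combination invCbrtX hU * h - D (invCbrtX hU) * cbrtX_mul_invCbrtX hU

theorem Dx_invCbrtX : Dx U (invCbrtX hU) = (-1 / 3 : ℂ) • invCbrtX hU ^ 4 := by
  rw [derivation_invCbrtX, Dx_cbrtX]
  refine ext_eval fun z => ?_
  simp only [map_mul, map_neg, map_pow, map_smul, smul_eq_mul]
  ring

theorem Dy_invCbrtX : Dy U (invCbrtX hU) = 0 := by
  rw [derivation_invCbrtX, Dy_cbrtX, mul_zero]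

theorem mulOp_eq (F : ℝ × ℝ → ℝ) (hF : ContDiffOn ℝ ∞ F U) (f : Smooth U) :
    mulOp U F hF f = ofReal U F hF * f := rfl

theorem p1_apply (ħ : ℝ) (f : Smooth U) : p1 U ħ f = (-Complex.I * ħ) • Dx U f := rfl

theorem p2_apply (ħ : ℝ) (f : Smooth U) : p2 U ħ f = (-Complex.I * ħ) • Dy U f := rfl

theorem neg_I_mul_sq (ħ : ℝ) : (-Complex.I * ħ) ^ 2 = -(ħ : ℂ) ^ 2 := by
  rw [mul_pow, neg_sq, Complex.I_sq]; ring

theorem eval_ofReal (F : ℝ × ℝ → ℝ) (hF : ContDiffOn ℝ ∞ F U) (z : U) :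
    eval z (ofReal U F hF) = F z := rfl

theorem ofReal_cbrt (a : ℝ) (h : ContDiffOn ℝ ∞ (fun z : ℝ × ℝ => a * cbrt z.1) U) :
    ofReal U _ h = (a : ℂ) • cbrtX hU :=
  ext_eval fun z => by
    rw [eval_ofReal, map_smul, eval_cbrtX, smul_eq_mul]
    push_cast
    rfl

theorem ofReal_potential (ħ a b c : ℝ)
    (h : ContDiffOn ℝ ∞ (fun z : ℝ × ℝ => a * z.2 / cbrt z.1 ^ 2 - b * ħ ^ 2 / (c * z.1 ^ 2)) U) :
    ofReal U _ h = (a : ℂ) • (coordY U * invCbrtX hU ^ 2)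
      + (b * (-Complex.I * ħ) ^ 2 / c : ℂ) • invCbrtX hU ^ 6 :=
  ext_eval fun z => by
    have h : (cbrt z.1.1 : ℂ) ≠ 0 := Complex.ofReal_ne_zero.2 (cbrt_ne_zero (hU z.2))
    have h3 : (z.1.1 : ℂ) = (cbrt z.1.1 : ℂ) ^ 3 := by exact_mod_cast (cbrt_pow_three _).symm
    rw [neg_I_mul_sq, eval_ofReal]
    simp only [map_add, map_smul, map_mul, map_pow, eval_invCbrtX, eval_coordY, smul_eq_mul]
    push_cast
    rw [h3]
    ring

theorem ofReal_scalarY (ħ α : ℝ) (h : ContDiffOn ℝ ∞ (scalarY ħ α) U) :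
    ofReal U _ h = (-18 * (α : ℂ) ^ 2) • cbrtX hU ^ 2
      + (4 * (α : ℂ) ^ 2) • (coordY U ^ 2 * invCbrtX hU ^ 4)
      + (5 * (α : ℂ) * (-Complex.I * ħ) ^ 2 / 9) • (coordY U * invCbrtX hU ^ 8)
      + (25 * (-Complex.I * ħ) ^ 4 / 1296 : ℂ) • invCbrtX hU ^ 12 :=
  ext_eval fun z => by
    have h : (cbrt z.1.1 : ℂ) ≠ 0 := Complex.ofReal_ne_zero.2 (cbrt_ne_zero (hU z.2))
    have h3 : (z.1.1 : ℂ) = (cbrt z.1.1 : ℂ) ^ 3 := by exact_mod_cast (cbrt_pow_three _).symm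
    have h4 : (-Complex.I * ħ) ^ 4 = (ħ : ℂ) ^ 4 := by
      linear_combination (((-Complex.I * ħ) ^ 2) - (ħ : ℂ) ^ 2) * neg_I_mul_sq ħ
    rw [h4, neg_I_mul_sq, eval_ofReal]
    simp only [map_add, map_smul, map_mul, map_pow, eval_invCbrtX, eval_coordY, eval_cbrtX,
      smul_eq_mul, scalarY]
    push_cast
    rw [h3]
    field_simp
    ring

theorem hamiltonian_apply (ħ α : ℝ) (hV : ContDiffOn ℝ ∞ (potential ħ α) U) (f : Smooth U) :
    hamiltonian U ħ (potential ħ α) hV f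
      = formH (Dx U) (Dy U) (-Complex.I * ħ) α (invCbrtX hU) (coordY U) f := by
  have h := ofReal_potential hU ħ α 5 72 hV
  simp only [hamiltonian, LinearMap.add_apply, LinearMap.smul_apply, mulOp_eq, formH, sq (p1 U ħ),
    sq (p2 U ħ), Module.End.mul_apply, p1_apply, p2_apply, Derivation.map_smul]
  rw [show ofReal U (potential ħ α) hV = _ from h]
  refine ext_eval fun z => ?_
  simp only [map_add, map_smul, map_mul, map_pow, smul_eq_mul]
  push_cast
  ring

theorem opH_apply (ħ α : ℝ) (f : Smooth regularPlane) :
    opH ħ α f = formH (Dx _) (Dy _) (-Complex.I * ħ) α (invCbrtX le_rfl) (coordY _) f :=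
  hamiltonian_apply le_rfl ħ α _ f

theorem pow_three_apply {M : Type*} [AddCommGroup M] [Module ℂ M] (T : Module.End ℂ M) (f : M) :
    (T ^ 3) f = T (T (T f)) := rfl

theorem pow_four_apply {M : Type*} [AddCommGroup M] [Module ℂ M] (T : Module.End ℂ M) (f : M) :
    (T ^ 4) f = T (T (T (T f))) := rfl

theorem pow_two_apply {M : Type*} [AddCommGroup M] [Module ℂ M] (T : Module.End ℂ M) (f : M) :
    (T ^ 2) f = T (T f) := rfl

theorem opX_apply (ħ α : ℝ) (f : Smooth regularPlane) :
    opX ħ α f = formX (Dx _) (Dy _) (-Complex.I * ħ) α (cbrtX le_rfl) (invCbrtX le_rfl)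
      (coordY _) f := by
  have h1 := ofReal_cbrt (U := regularPlane) le_rfl (9 * α / 2) (smooth_aux1 _)
  have h2 := ofReal_potential (U := regularPlane) le_rfl ħ (3 * α) 5 24
    (smooth_aux2 _ _ _ (by norm_num))
  simp only [opX, anticomm, LinearMap.add_apply, LinearMap.smul_apply, mulOp_eq, formX,
    pow_two_apply, pow_three_apply, Module.End.mul_apply, p1_apply, p2_apply, Derivation.map_smul,
    h1, h2, add_mul, map_add, smul_mul_assoc, mul_smul_comm]
  refine ext_eval fun z => ?_
  simp only [map_add, map_smul, map_mul, map_pow, smul_eq_mul]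
  push_cast
  ring

theorem opY_apply (ħ α : ℝ) (f : Smooth regularPlane) :
    opY ħ α f = formY (Dx _) (Dy _) (-Complex.I * ħ) α (cbrtX le_rfl) (invCbrtX le_rfl)
      (coordY _) f := by
  have h1 := ofReal_cbrt (U := regularPlane) le_rfl (6 * α) (smooth_aux1 _)
  have h2 := ofReal_potential (U := regularPlane) le_rfl ħ (2 * α) 5 36
    (smooth_aux2 _ _ _ (by norm_num))
  have h3 := ofReal_scalarY (U := regularPlane) le_rfl ħ α (smooth_scalarY ħ α)
  simp only [opY, anticomm, LinearMap.add_apply, LinearMap.sub_apply, mulOp_eq, formY,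
    pow_two_apply, pow_four_apply, Module.End.mul_apply, p1_apply, p2_apply, Derivation.map_smul,
    h1, h2, h3, add_mul, map_add, smul_mul_assoc, mul_smul_comm]
  refine ext_eval fun z => ?_
  simp only [map_add, map_sub, map_smul, map_mul, map_pow, smul_eq_mul]
  push_cast
  ring

theorem opH_opX_comm (ħ α : ℝ) : opH ħ α * opX ħ α = opX ħ α * opH ħ α :=
  LinearMap.ext fun f => ext_eval fun z => by
    simp only [Module.End.mul_apply, opH_apply, opX_apply]
    exact formH_formX_comm (X := Dx regularPlane) (Y := Dy regularPlane) Dx_Dy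
      (cbrtX_mul_invCbrtX le_rfl) (Dx_cbrtX le_rfl) (Dx_invCbrtX le_rfl)
      (Dy_cbrtX le_rfl) (Dy_invCbrtX le_rfl) Dx_coordY Dy_coordY (-Complex.I * ħ) α f (eval z)

theorem opH_opY_comm (ħ α : ℝ) : opH ħ α * opY ħ α = opY ħ α * opH ħ α :=
  LinearMap.ext fun f => ext_eval fun z => by
    simp only [Module.End.mul_apply, opH_apply, opY_apply]
    exact formH_formY_comm (X := Dx regularPlane) (Y := Dy regularPlane) Dx_Dy
      (cbrtX_mul_invCbrtX le_rfl) (Dx_cbrtX le_rfl) (Dx_invCbrtX le_rfl)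
      (Dy_cbrtX le_rfl) (Dy_invCbrtX le_rfl) Dx_coordY Dy_coordY (-Complex.I * ħ) α f (eval z)

/-- The operators `X` and `Y` generate a Heisenberg algebra. -/
theorem opX_opY_comm (ħ α : ℝ) : opX ħ α * opY ħ α - opY ħ α * opX ħ α
    = algebraMap ℂ _ (-108 * (-Complex.I * ħ) * (α : ℂ) ^ 3) :=
  LinearMap.ext fun f => ext_eval fun z => by
    simp only [Module.End.mul_apply, opX_apply, opY_apply, LinearMap.sub_apply,
      Module.algebraMap_end_apply, map_sub]
    rw [formX_formY_comm (X := Dx regularPlane) (Y := Dy regularPlane) Dx_Dy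
      (cbrtX_mul_invCbrtX le_rfl) (Dx_cbrtX le_rfl) (Dx_invCbrtX le_rfl)
      (Dy_cbrtX le_rfl) (Dy_invCbrtX le_rfl) Dx_coordY Dy_coordY (-Complex.I * ħ) α f
        (eval z), add_sub_cancel_left]

end QuantumPlane
end

/-! ### Order of differential operators through iterated commutators -/

noncomputable section
namespace QuantumPlane
open Smooth

section Commutator
variable {R : Type*} [Ring R] [Algebra ℂ R]

/-- The commutator `TM - MT` as a linear map of `T`. -/
def commutatorRight (M : R) : R →ₗ[ℂ] R := LinearMap.mulRight ℂ M - LinearMap.mulLeft ℂ M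

theorem commutatorRight_apply (M T : R) : commutatorRight M T = T * M - M * T := rfl

theorem commutatorRight_mul (M A B : R) :
    commutatorRight M (A * B) = A * commutatorRight M B + commutatorRight M A * B := by
  simp only [commutatorRight_apply]; noncomm_ring

theorem commutatorRight_eq_of_eq {M A C : R} (h : A * M = C + M * A) :
    commutatorRight M A = C := by
  rw [commutatorRight_apply, h, add_sub_cancel_right]

theorem commutatorRight_eq_zero {M A : R} (h : A * M = M * A) : commutatorRight M A = 0 := by
  rw [commutatorRight_apply, h, sub_self]

end Commutator

section Order
variable {U : Opens (ℝ × ℝ)}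

/-- Multiplication by a smooth function, as an operator. -/
def mulEnd (f : Smooth U) : Module.End ℂ (Smooth U) := LinearMap.mulLeft ℂ f

theorem mulEnd_apply (f g : Smooth U) : mulEnd f g = f * g := rfl

theorem mulEnd_one : mulEnd (1 : Smooth U) = 1 := LinearMap.ext fun g => one_mul g

theorem mulEnd_mul_mulEnd (f g : Smooth U) : mulEnd f * mulEnd g = mulEnd (f * g) :=
  LinearMap.ext fun h => (mul_assoc f g h).symm

theorem mulEnd_comm (f g : Smooth U) : mulEnd f * mulEnd g = mulEnd g * mulEnd f := by
  rw [mulEnd_mul_mulEnd, mulEnd_mul_mulEnd, mul_comm]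

theorem dx_mul_mulEnd (f : Smooth U) : dx U * mulEnd f = mulEnd (Dx U f) + mulEnd f * dx U :=
  LinearMap.ext fun g => by
    simp only [Module.End.mul_apply, LinearMap.add_apply, mulEnd_apply, dx_apply,
      Derivation.leibniz, smul_eq_mul]
    ring

theorem dy_mul_mulEnd (f : Smooth U) : dy U * mulEnd f = mulEnd (Dy U f) + mulEnd f * dy U :=
  LinearMap.ext fun g => by
    simp only [Module.End.mul_apply, LinearMap.add_apply, mulEnd_apply, dy_apply,
      Derivation.leibniz, smul_eq_mul]
    ring

theorem dx_mul_dy : dx U * dy U = dy U * dx U := LinearMap.ext fun g => Dx_Dy g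

theorem diffOps_mono {m n : ℕ} (h : m ≤ n) : diffOps U m ≤ diffOps U n := by
  refine Submodule.span_mono ?_
  rintro T ⟨f, j, k, hjk, rfl⟩
  exact ⟨f, j, k, hjk.trans h, rfl⟩

theorem monomial_mem_diffOps (f : Smooth U) {j k n : ℕ} (h : j + k ≤ n) :
    mulEnd f * (dx U ^ j * dy U ^ k) ∈ diffOps U n :=
  Submodule.subset_span ⟨f, j, k, h, rfl⟩

theorem diffOps_induction {n : ℕ} {p : Module.End ℂ (Smooth U) → Prop}
    (hmon : ∀ f j k, j + k ≤ n → p (mulEnd f * (dx U ^ j * dy U ^ k))) (hzero : p 0)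
    (hadd : ∀ S T, p S → p T → p (S + T)) (hsmul : ∀ (c : ℂ) T, p T → p (c • T))
    {T : Module.End ℂ (Smooth U)} (hT : T ∈ diffOps U n) : p T := by
  refine Submodule.span_induction (p := fun T _ => p T) ?_ hzero (fun S T _ _ => hadd S T)
    (fun c T _ => hsmul c T) hT
  rintro T ⟨f, j, k, h, rfl⟩
  exact hmon f j k h

theorem mulEnd_mem_diffOps (f : Smooth U) : mulEnd f ∈ diffOps U 0 := by
  simpa using monomial_mem_diffOps f (j := 0) (k := 0) le_rfl

theorem mulEnd_mul_mem_diffOps (f : Smooth U) {n : ℕ} {T : Module.End ℂ (Smooth U)}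
    (hT : T ∈ diffOps U n) : mulEnd f * T ∈ diffOps U n := by
  refine diffOps_induction (p := fun T => mulEnd f * T ∈ diffOps U n) ?_ ?_ ?_ ?_ hT
  · intro g j k h
    rw [← mul_assoc, mulEnd_mul_mulEnd]
    exact monomial_mem_diffOps _ h
  · simp
  · intro S T hS hT
    rw [mul_add]; exact add_mem hS hT
  · intro c T hT
    rw [mul_smul_comm]; exact Submodule.smul_mem _ _ hT

theorem dx_mul_mem_diffOps {n : ℕ} {T : Module.End ℂ (Smooth U)} (hT : T ∈ diffOps U n) :
    dx U * T ∈ diffOps U (n + 1) := by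
  refine diffOps_induction (p := fun T => dx U * T ∈ diffOps U (n + 1)) ?_ ?_ ?_ ?_ hT
  · intro g j k h
    rw [← mul_assoc, dx_mul_mulEnd, add_mul, mul_assoc, ← mul_assoc (dx U), ← pow_succ']
    exact add_mem (monomial_mem_diffOps _ (by omega)) (monomial_mem_diffOps _ (by omega))
  · simp
  · intro S T hS hT
    rw [mul_add]; exact add_mem hS hT
  · intro c T hT
    rw [mul_smul_comm]; exact Submodule.smul_mem _ _ hT

theorem dy_mul_mem_diffOps {n : ℕ} {T : Module.End ℂ (Smooth U)} (hT : T ∈ diffOps U n) :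
    dy U * T ∈ diffOps U (n + 1) := by
  refine diffOps_induction (p := fun T => dy U * T ∈ diffOps U (n + 1)) ?_ ?_ ?_ ?_ hT
  · intro g j k h
    have hc : dy U * dx U ^ j = dx U ^ j * dy U :=
      (Commute.pow_left (show Commute (dx U) (dy U) from dx_mul_dy) j).eq.symm
    rw [← mul_assoc, dy_mul_mulEnd, add_mul, mul_assoc, ← mul_assoc (dy U), hc, mul_assoc,
      ← pow_succ']
    exact add_mem (monomial_mem_diffOps _ (by omega)) (monomial_mem_diffOps _ (by omega))
  · simp
  · intro S T hS hT
    rw [mul_add]; exact add_mem hS hT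
  · intro c T hT
    rw [mul_smul_comm]; exact Submodule.smul_mem _ _ hT

theorem dx_mem_diffOps : dx U ∈ diffOps U 1 := by
  simpa [mulEnd_one] using monomial_mem_diffOps (1 : Smooth U) (j := 1) (k := 0) le_rfl

theorem dy_mem_diffOps : dy U ∈ diffOps U 1 := by
  simpa [mulEnd_one] using monomial_mem_diffOps (1 : Smooth U) (j := 0) (k := 1) le_rfl

theorem mul_mem_diffOps {m n : ℕ} {S T : Module.End ℂ (Smooth U)} (hS : S ∈ diffOps U m)
    (hT : T ∈ diffOps U n) : S * T ∈ diffOps U (m + n) := by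
  have hy : ∀ k, dy U ^ k * T ∈ diffOps U (k + n) := by
    intro k
    induction k with
    | zero => simpa using hT
    | succ k ih =>
      rw [pow_succ', mul_assoc, show k + 1 + n = k + n + 1 by omega]
      exact dy_mul_mem_diffOps ih
  have hx : ∀ j k, dx U ^ j * dy U ^ k * T ∈ diffOps U (j + k + n) := by
    intro j k
    rw [mul_assoc]
    induction j with
    | zero => simpa using hy k
    | succ j ih =>
      rw [pow_succ', mul_assoc, show j + 1 + k + n = j + k + n + 1 by omega]
      exact dx_mul_mem_diffOps ih
  refine diffOps_induction (p := fun S => S * T ∈ diffOps U (m + n)) ?_ ?_ ?_ ?_ hS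
  · intro f j k h
    rw [mul_assoc]
    exact diffOps_mono (by omega) (mulEnd_mul_mem_diffOps f (hx j k))
  · simp
  · intro S S' hS hS'
    rw [add_mul]; exact add_mem hS hS'
  · intro c S hS
    rw [smul_mul_assoc]; exact Submodule.smul_mem _ _ hS

/-- The commutator with a function g is a derivation that sends ∂ₓ and ∂ᵧ to multiplication
operators, so each application costs one order. The induction peels off one derivative at a time. -/
theorem commutator_monomial_mem_diffOps (g : Smooth U) {j k n : ℕ} (h : j + k ≤ n + 1) :
    commutatorRight (mulEnd g) (dx U ^ j * dy U ^ k) ∈ diffOps U n := by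
  have step : ∀ {A B : Module.End ℂ (Smooth U)} {n : ℕ} (g' : Smooth U), A ∈ diffOps U 1 →
      A * mulEnd g = mulEnd g' + mulEnd g * A → B ∈ diffOps U n →
      (n = 0 → commutatorRight (mulEnd g) B = 0) →
      commutatorRight (mulEnd g) B ∈ diffOps U (n - 1) →
      commutatorRight (mulEnd g) (A * B) ∈ diffOps U n := by
    intro A B n g' hA hAg hB h0 hn
    rw [commutatorRight_mul, commutatorRight_eq_of_eq (A := A) hAg]
    refine add_mem ?_ (mulEnd_mul_mem_diffOps _ hB)
    rcases Nat.eq_zero_or_pos n with hn0 | hn0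
    · rw [h0 hn0, mul_zero]; exact zero_mem _
    · exact diffOps_mono (by omega) (mul_mem_diffOps hA hn)
  -- Since n - 1 is truncated, membership in order n - 1 says too little at n = 0; there the
  -- induction needs that the commutator vanishes.
  have main : ∀ j k n, j + k = n →
      (n = 0 → commutatorRight (mulEnd g) (dx U ^ j * dy U ^ k) = 0) ∧
      commutatorRight (mulEnd g) (dx U ^ j * dy U ^ k) ∈ diffOps U (n - 1) := by
    intro j
    induction j with
    | zero =>
      intro k
      induction k with
      | zero =>
        intro n _
        have h0 : commutatorRight (mulEnd g) (dx U ^ 0 * dy U ^ 0) = 0 :=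
          commutatorRight_eq_zero (by simp)
        exact ⟨fun _ => h0, by rw [h0]; exact zero_mem _⟩
      | succ k ih =>
        rintro n rfl
        refine ⟨by omega, ?_⟩
        have := ih k (by omega)
        rw [pow_succ', ← mul_assoc, (Commute.pow_left (show Commute (dx U) (dy U) from
          dx_mul_dy) 0).eq, mul_assoc (dy U)]
        refine diffOps_mono ?_ (step (n := k) _ dy_mem_diffOps (dy_mul_mulEnd g) ?_ this.1 this.2)
        · omega
        · simpa [mulEnd_one] using
            monomial_mem_diffOps (1 : Smooth U) (j := 0) (k := k) (n := k) (by omega)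
    | succ j ih =>
      rintro k n rfl
      refine ⟨by omega, ?_⟩
      have := ih k (j + k) rfl
      rw [pow_succ', mul_assoc (dx U)]
      refine diffOps_mono ?_ (step (n := j + k) _ dx_mem_diffOps (dx_mul_mulEnd g) ?_
        this.1 this.2)
      · omega
      · simpa [mulEnd_one] using
          monomial_mem_diffOps (1 : Smooth U) (j := j) (k := k) (n := j + k) le_rfl
  exact diffOps_mono (by omega) (main j k _ rfl).2

theorem commutator_mem_diffOps (g : Smooth U) {n : ℕ} {T : Module.End ℂ (Smooth U)}
    (hT : T ∈ diffOps U (n + 1)) : commutatorRight (mulEnd g) T ∈ diffOps U n := by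
  refine diffOps_induction (p := fun T => commutatorRight (mulEnd g) T ∈ diffOps U n) ?_ ?_ ?_ ?_ hT
  · intro f j k h
    rw [commutatorRight_mul, commutatorRight_eq_zero (A := mulEnd f) (mulEnd_comm f g), zero_mul,
      add_zero]
    exact mulEnd_mul_mem_diffOps _ (commutator_monomial_mem_diffOps g h)
  · rw [map_zero]; exact zero_mem _
  · intro S T hS hT
    rw [map_add]; exact add_mem hS hT
  · intro c T hT
    rw [map_smul]; exact Submodule.smul_mem _ _ hT

theorem commutator_eq_zero (g : Smooth U) {T : Module.End ℂ (Smooth U)}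
    (hT : T ∈ diffOps U 0) : commutatorRight (mulEnd g) T = 0 := by
  refine diffOps_induction (p := fun T => commutatorRight (mulEnd g) T = 0) ?_ ?_ ?_ ?_ hT
  · intro f j k h
    obtain ⟨rfl, rfl⟩ : j = 0 ∧ k = 0 := by omega
    rw [pow_zero, pow_zero, mul_one, mul_one, commutatorRight_eq_zero (mulEnd_comm f g)]
  · exact map_zero _
  · intro S T hS hT
    rw [map_add, hS, hT, add_zero]
  · intro c T hT
    rw [map_smul, hT, smul_zero]

theorem commutator_iterate_eq_zero (g : Smooth U) {n : ℕ} :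
    ∀ {T : Module.End ℂ (Smooth U)}, T ∈ diffOps U n →
      (commutatorRight (mulEnd g))^[n + 1] T = 0 := by
  induction n with
  | zero => exact fun hT => commutator_eq_zero g hT
  | succ n ih => exact fun hT => ih (commutator_mem_diffOps g hT)

/-- An operator of order at most n is annihilated by n + 1 commutators with functions, so a
surviving (n + 1)-fold commutator excludes every smaller order. -/
theorem hasOrder_of_commutator_iterate {L : Module.End ℂ (Smooth U)} {n : ℕ}
    (hL : L ∈ diffOps U (n + 1)) (g : Smooth U)
    (h : (commutatorRight (mulEnd g))^[n + 1] L ≠ 0) : HasOrder L (n + 1) :=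
  ⟨hL, fun _ hm hLm => h (commutator_iterate_eq_zero g (diffOps_mono (by omega) hLm))⟩

theorem pow_mem_diffOps {m : ℕ} {T : Module.End ℂ (Smooth U)} (hT : T ∈ diffOps U m) (k : ℕ) :
    T ^ k ∈ diffOps U (k * m) := by
  induction k with
  | zero => simpa [mulEnd_one] using mulEnd_mem_diffOps (1 : Smooth U)
  | succ k ih => rw [pow_succ, Nat.succ_mul]; exact mul_mem_diffOps ih hT

theorem mulOp_mem_diffOps (F : ℝ × ℝ → ℝ) (hF : ContDiffOn ℝ ∞ F U) :
    mulOp U F hF ∈ diffOps U 0 := mulEnd_mem_diffOps _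

theorem p1_mem_diffOps (ħ : ℝ) : p1 U ħ ∈ diffOps U 1 := Submodule.smul_mem _ _ dx_mem_diffOps

theorem p2_mem_diffOps (ħ : ℝ) : p2 U ħ ∈ diffOps U 1 := Submodule.smul_mem _ _ dy_mem_diffOps

theorem anticomm_mem_diffOps {m n : ℕ} {S T : Module.End ℂ (Smooth U)} (hS : S ∈ diffOps U m)
    (hT : T ∈ diffOps U n) : anticomm S T ∈ diffOps U (m + n) :=
  add_mem (mul_mem_diffOps hS hT) (by rw [add_comm m]; exact mul_mem_diffOps hT hS)

end Order

theorem opH_mem_diffOps (ħ α : ℝ) : opH ħ α ∈ diffOps regularPlane 2 :=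
  add_mem (Submodule.smul_mem _ _ (add_mem
    (diffOps_mono (m := 2 * 1) (by omega) (pow_mem_diffOps (p1_mem_diffOps ħ) 2))
    (diffOps_mono (m := 2 * 1) (by omega) (pow_mem_diffOps (p2_mem_diffOps ħ) 2))))
    (diffOps_mono (by omega) (mulOp_mem_diffOps _ _))

theorem opX_mem_diffOps (ħ α : ℝ) : opX ħ α ∈ diffOps regularPlane 3 := by
  have hP := p1_mem_diffOps (U := regularPlane) ħ
  have hQ := p2_mem_diffOps (U := regularPlane) ħ
  simp only [opX]
  refine add_mem (add_mem (add_mem ?_ ?_) ?_) ?_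
  · exact Submodule.smul_mem _ _ (diffOps_mono (m := 2 * 1 + 1) (by omega)
      (mul_mem_diffOps (pow_mem_diffOps hP 2) hQ))
  · exact Submodule.smul_mem _ _ (diffOps_mono (m := 3 * 1) (by omega) (pow_mem_diffOps hQ 3))
  · exact diffOps_mono (m := 0 + 1) (by omega) (anticomm_mem_diffOps (mulOp_mem_diffOps _ _) hP)
  · exact diffOps_mono (m := 0 + 1) (by omega) (anticomm_mem_diffOps (mulOp_mem_diffOps _ _) hQ)

theorem sub_mem_diffOps {U : Opens (ℝ × ℝ)} {n : ℕ} {S T : Module.End ℂ (Smooth U)}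
    (hS : S ∈ diffOps U n) (hT : T ∈ diffOps U n) : S - T ∈ diffOps U n := by
  have : S - T = S + (-1 : ℂ) • T := LinearMap.ext fun f => by
    rw [LinearMap.sub_apply, LinearMap.add_apply, LinearMap.smul_apply, neg_one_smul,
      sub_eq_add_neg]
  rw [this]
  exact add_mem hS (Submodule.smul_mem _ _ hT)

theorem opY_mem_diffOps (ħ α : ℝ) : opY ħ α ∈ diffOps regularPlane 4 := by
  have hP := p1_mem_diffOps (U := regularPlane) ħ
  have hQ := p2_mem_diffOps (U := regularPlane) ħ
  simp only [opY]
  refine add_mem (sub_mem_diffOps (add_mem ?_ ?_) ?_) ?_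
  · exact diffOps_mono (m := 4 * 1) (by omega) (pow_mem_diffOps hP 4)
  · exact diffOps_mono (m := 0 + 2 * 1) (by omega)
      (anticomm_mem_diffOps (mulOp_mem_diffOps _ _) (pow_mem_diffOps hP 2))
  · exact diffOps_mono (m := 0 + (1 + 1)) (by omega)
      (anticomm_mem_diffOps (mulOp_mem_diffOps _ _) (mul_mem_diffOps hP hQ))
  · exact diffOps_mono (by omega) (mulOp_mem_diffOps _ _)

section
variable {S : Type*} [CommRing S] [Algebra ℂ S] {X Y : Derivation ℂ S S}

-- The alternating sum is the threefold commutator with y, applied to 1. Only third-order terms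
-- survive; as `X y = 0`, only 2k³Y³ contributes, which gives 3! · 2k³.
set_option linter.unusedSimpArgs false in
theorem formX_third_commutator {y : S} (hXy : X y = 0) (hYy : Y y = 1) (k a : ℂ) (t w : S)
    (e : S →ₐ[ℂ] ℂ) :
    e (formX X Y k a t w y (y ^ 3) - 3 * (y * formX X Y k a t w y (y ^ 2))
      + 3 * (y ^ 2 * formX X Y k a t w y y) - y ^ 3 * formX X Y k a t w y 1) = 12 * k ^ 3 := by
  have h01 (D : Derivation ℂ S S) : D 0 = 0 := D.map_zero
  have h02 (D : Derivation ℂ S S) : D 1 = 0 := D.map_one_eq_zero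
  have hn (D : Derivation ℂ S S) (n : ℕ) [n.AtLeastTwo] : D (OfNat.ofNat n : S) = 0 :=
    D.map_natCast n
  simp only [formX, hn, h01, h02, Nat.cast_zero, Nat.cast_one, pow_zero, pow_one, Nat.cast_ofNat,
    Nat.reduceSub, map_ofNat, map_add, map_sub, map_smul, Derivation.map_smul, Derivation.leibniz,
    Derivation.leibniz_pow, hXy, hYy, smul_eq_mul, map_mul, map_pow, map_zero, map_one,
    smul_zero, mul_zero, add_zero, zero_add, map_nsmul, nsmul_eq_mul, smul_add, map_natCast]
  ring

-- The fourfold commutator with x, applied to 1, sees only the term k⁴X⁴ and gives 4! k⁴.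
set_option linter.unusedSimpArgs false in
theorem formY_fourth_commutator {x : S} (hXx : X x = 1) (hYx : Y x = 0) (k a : ℂ) (t w y : S)
    (e : S →ₐ[ℂ] ℂ) :
    e (formY X Y k a t w y (x ^ 4) - 4 * (x * formY X Y k a t w y (x ^ 3))
      + 6 * (x ^ 2 * formY X Y k a t w y (x ^ 2)) - 4 * (x ^ 3 * formY X Y k a t w y x)
      + x ^ 4 * formY X Y k a t w y 1) = 24 * k ^ 4 := by
  have h01 (D : Derivation ℂ S S) : D 0 = 0 := D.map_zero
  have h02 (D : Derivation ℂ S S) : D 1 = 0 := D.map_one_eq_zero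
  have hn (D : Derivation ℂ S S) (n : ℕ) [n.AtLeastTwo] : D (OfNat.ofNat n : S) = 0 :=
    D.map_natCast n
  simp only [formY, hn, h01, h02, Nat.cast_zero, Nat.cast_one, pow_zero, pow_one, Nat.cast_ofNat,
    Nat.reduceSub, map_ofNat, map_add, map_sub, map_smul, Derivation.map_smul, Derivation.leibniz,
    Derivation.leibniz_pow, hXx, hYx, smul_eq_mul, map_mul, map_pow, map_zero, map_one,
    smul_zero, mul_zero, add_zero, zero_add, map_nsmul, nsmul_eq_mul, smul_add, map_natCast]
  ring

end

theorem neg_I_mul_ne_zero {ħ : ℝ} (hħ : 0 < ħ) : (-Complex.I * ħ : ℂ) ≠ 0 :=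
  mul_ne_zero (neg_ne_zero.2 Complex.I_ne_zero) (Complex.ofReal_ne_zero.2 hħ.ne')

theorem regularPlane_nonempty : Nonempty regularPlane := ⟨⟨(1, 0), one_ne_zero⟩⟩

theorem commutatorRight_end_apply {U : Opens (ℝ × ℝ)} (M T : Module.End ℂ (Smooth U))
    (f : Smooth U) : commutatorRight M T f = T (M f) - M (T f) := rfl

theorem opX_hasOrder {ħ : ℝ} (hħ : 0 < ħ) (α : ℝ) : HasOrder (opX ħ α) 3 := by
  obtain ⟨z⟩ := regularPlane_nonempty
  refine hasOrder_of_commutator_iterate (opX_mem_diffOps ħ α) (coordY _) fun h => ?_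
  have h1 := congrArg (eval z) (LinearMap.congr_fun h 1)
  refine mul_ne_zero (by norm_num) (pow_ne_zero 3 (neg_I_mul_ne_zero hħ)) (a := (12 : ℂ)) ?_
  rw [← formX_third_commutator (X := Dx regularPlane) (Y := Dy regularPlane) Dx_coordY Dy_coordY
    _ α (cbrtX le_rfl) (invCbrtX le_rfl) (eval z)]
  simp only [← opX_apply]
  rw [LinearMap.zero_apply, map_zero] at h1
  rw [← h1]
  congr 1
  simp only [Function.iterate_succ, Function.iterate_zero, Function.comp_apply, id_eq,
    commutatorRight_end_apply, mulEnd_apply, mul_one]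
  simp only [pow_succ, pow_zero, one_mul, mul_assoc]
  ring

theorem opY_hasOrder {ħ : ℝ} (hħ : 0 < ħ) (α : ℝ) : HasOrder (opY ħ α) 4 := by
  obtain ⟨z⟩ := regularPlane_nonempty
  refine hasOrder_of_commutator_iterate (opY_mem_diffOps ħ α) (coordX _) fun h => ?_
  have h1 := congrArg (eval z) (LinearMap.congr_fun h 1)
  refine mul_ne_zero (by norm_num) (pow_ne_zero 4 (neg_I_mul_ne_zero hħ)) (a := (24 : ℂ)) ?_
  rw [← formY_fourth_commutator (X := Dx regularPlane) (Y := Dy regularPlane) Dx_coordX Dy_coordX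
    _ α (cbrtX le_rfl) (invCbrtX le_rfl) (coordY _) (eval z)]
  simp only [← opY_apply]
  rw [LinearMap.zero_apply, map_zero] at h1
  rw [← h1]
  congr 1
  simp only [Function.iterate_succ, Function.iterate_zero, Function.comp_apply, id_eq,
    commutatorRight_end_apply, mulEnd_apply, mul_one]
  simp only [pow_succ, pow_zero, one_mul, mul_assoc]
  ring

end QuantumPlane
end

/-! ### Algebraic independence from the Heisenberg relation -/

noncomputable section
namespace QuantumPlane
open Smooth

section Words
variable {R ι : Type*} [Ring R] [Algebra ℂ R] [DecidableEq ι]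

/-- The higher Leibniz rule, cut off after two terms because the second commutator of A with M is
zero. -/
theorem pow_commutatorRight_mul_of_eq (M : R) {A : R} {κ : ℂ}
    (hA : commutatorRight M A = algebraMap ℂ R κ) (B : R) (n : ℕ) :
    ((commutatorRight M) ^ (n + 1)) (A * B)
      = A * ((commutatorRight M) ^ (n + 1)) B
        + ((n + 1 : ℕ) * κ) • ((commutatorRight M) ^ n) B := by
  induction n generalizing B with
  | zero =>
    simp only [zero_add, pow_one, pow_zero, Module.End.one_apply, commutatorRight_mul, hA,
      Nat.cast_one, one_mul, Algebra.smul_def]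
  | succ n ih =>
    have hp : ∀ k B, ((commutatorRight M) ^ (k + 1)) B
        = ((commutatorRight M) ^ k) (commutatorRight M B) := fun k B => by
      rw [pow_succ, Module.End.mul_apply]
    rw [hp (n + 1) (A * B), commutatorRight_mul, map_add, ih, hA,
      ← Algebra.smul_def, map_smul, ← hp (n + 1), ← hp n, add_assoc, ← add_smul]
    congr 2
    push_cast
    ring

theorem pow_commutatorRight_mul_of_eq_zero (M : R) {A : R} (hA : commutatorRight M A = 0) (B : R)
    (n : ℕ) : ((commutatorRight M) ^ n) (A * B) = A * ((commutatorRight M) ^ n) B := by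
  induction n generalizing B with
  | zero => simp
  | succ n ih =>
    rw [pow_succ, Module.End.mul_apply, commutatorRight_mul, hA, zero_mul, add_zero, ih,
      Module.End.mul_apply]

/-- The commutator with M is a derivation that kills every letter except `S i₀`, which it replaces
by κ. Each application deletes one occurrence of that letter; the factorial counts the orders of
deletion, and one application too many gives zero. -/
theorem pow_commutatorRight_word (M : R) {S : ι → R} {i₀ : ι} {κ : ℂ}
    (h₀ : commutatorRight M (S i₀) = algebraMap ℂ R κ)
    (h : ∀ i ≠ i₀, commutatorRight M (S i) = 0) (l : List ι) :
    (∀ n, l.count i₀ < n → ((commutatorRight M) ^ n) (l.map S).prod = 0) ∧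
    ((commutatorRight M) ^ (l.count i₀)) (l.map S).prod
      = (((l.count i₀).factorial : ℂ) * κ ^ (l.count i₀)) • ((l.filter (· ≠ i₀)).map S).prod := by
  induction l with
  | nil =>
    refine ⟨fun n hn => ?_, by simp⟩
    obtain ⟨m, rfl⟩ := Nat.exists_eq_succ_of_ne_zero (Nat.ne_of_gt hn)
    rw [pow_succ, Module.End.mul_apply, List.map_nil, List.prod_nil,
      commutatorRight_eq_zero (by simp), map_zero]
  | cons i l ih =>
    rw [List.map_cons, List.prod_cons]
    by_cases hi : i = i₀
    · subst hi
      rw [List.count_cons_self, List.filter_cons_of_neg (by simp)]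
      refine ⟨fun n hn => ?_, ?_⟩
      · obtain ⟨m, rfl⟩ := Nat.exists_eq_succ_of_ne_zero (Nat.ne_of_gt (Nat.zero_lt_of_lt hn))
        rw [Nat.succ_eq_add_one, pow_commutatorRight_mul_of_eq M h₀, ih.1 _ (by omega),
          ih.1 _ (by omega), mul_zero, smul_zero, add_zero]
      · rw [pow_commutatorRight_mul_of_eq M h₀, ih.1 _ (by omega), ih.2, mul_zero, zero_add,
          smul_smul]
        congr 1
        rw [Nat.factorial_succ]
        push_cast
        ring
    · rw [List.count_cons_of_ne (Ne.symm (Ne.symm hi)), List.filter_cons_of_pos (by simpa using hi)]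
      refine ⟨fun n hn => ?_, ?_⟩
      · rw [pow_commutatorRight_mul_of_eq_zero M (h i hi), ih.1 n hn, mul_zero]
      · rw [pow_commutatorRight_mul_of_eq_zero M (h i hi), ih.2, mul_smul_comm, List.map_cons,
          List.prod_cons]

end Words

section Heisenberg
variable {R : Type*} [Ring R] [Algebra ℂ R] {S : Fin 3 → R} {κ : ℂ}

/-- By the Jacobi identity, the commutator of the two maps is, up to sign, the commutator with the
central element κ. -/
theorem commutatorRight_comm {A B : R} (h : A * B - B * A = algebraMap ℂ R κ) :
    Commute (commutatorRight B) (commutatorRight A) := by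
  refine LinearMap.ext fun T => ?_
  simp only [Module.End.mul_apply, commutatorRight_apply]
  have := Algebra.commutes κ T
  rw [← h] at this
  rw [← sub_eq_zero] at this ⊢
  rw [← neg_eq_zero, ← this]
  noncomm_ring

/-- Commutators with `S 2` delete letters `S 1` and commutators with `S 1` delete letters `S 2`,
with opposite constants. When the counts match exactly, only the letters `S 0` are left. -/
theorem pow_commutatorRight_lists (hS1 : S 0 * S 1 = S 1 * S 0) (hS2 : S 0 * S 2 = S 2 * S 0)
    (hκ : S 1 * S 2 - S 2 * S 1 = algebraMap ℂ R κ) (a b : ℕ) (l : List (Fin 3)) :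
    (l.count 1 < a ∨ l.count 2 < b →
      (commutatorRight (S 1) ^ b) ((commutatorRight (S 2) ^ a) (l.map S).prod) = 0) ∧
    (l.count 1 = a → l.count 2 = b →
      (commutatorRight (S 1) ^ b) ((commutatorRight (S 2) ^ a) (l.map S).prod)
        = ((a.factorial * κ ^ a) * (b.factorial * (-κ) ^ b) : ℂ) • S 0 ^ l.count 0) := by
  have h1 := pow_commutatorRight_word (S 2) (S := S) (i₀ := 1) (κ := κ) hκ (by
    intro i hi
    fin_cases i
    · exact commutatorRight_eq_zero hS2
    · exact absurd rfl hi
    · exact commutatorRight_eq_zero rfl)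
  have h2 := pow_commutatorRight_word (S 1) (S := S) (i₀ := 2) (κ := -κ) (by
    rw [map_neg, ← hκ, commutatorRight_apply, neg_sub]) (by
    intro i hi
    fin_cases i
    · exact commutatorRight_eq_zero hS1
    · exact commutatorRight_eq_zero rfl
    · exact absurd rfl hi)
  constructor
  · rintro (hl | hl)
    · rw [(h1 l).1 a hl, map_zero]
    -- With too few letters `S 2`, the commutators with `S 1` are made to act first.
    · have hc := ((commutatorRight_comm hκ).pow_pow a b).eq
      rw [← Module.End.mul_apply, ← hc, Module.End.mul_apply, (h2 l).1 b hl, map_zero]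
  · rintro rfl rfl
    have hc : (l.filter (· ≠ 1)).count 2 = l.count 2 := List.count_filter (by decide)
    rw [(h1 l).2, map_smul, ← hc, (h2 _).2, hc, smul_smul, List.filter_filter]
    congr 1
    have hf : l.filter (fun i => decide (i ≠ 2) && decide (i ≠ 1)) = l.filter (· == 0) := by
      refine List.filter_congr fun i _ => ?_
      fin_cases i <;> rfl
    rw [hf, List.filter_beq, List.map_replicate, List.prod_replicate]

theorem count_of_mem_lists {m : Fin 3 →₀ ℕ} {l : List (Fin 3)}
    (hl : l ∈ (Finsupp.toMultiset m).lists) (i : Fin 3) : l.count i = m i := by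
  rw [Multiset.mem_lists_iff] at hl
  rw [← Multiset.coe_count, ← Finsupp.count_toMultiset, hl]
  rfl

theorem lists_card_ne_zero (m : Fin 3 →₀ ℕ) : (Finsupp.toMultiset m).lists.card ≠ 0 := by
  obtain ⟨l, hl⟩ := Quot.exists_rep (Finsupp.toMultiset m)
  rw [← hl]
  have : l ∈ (Multiset.lists (Quot.mk _ l)) := (Multiset.mem_lists_iff _ _).2 rfl
  exact (Multiset.card_pos_iff_exists_mem.2 ⟨l, this⟩).ne'

/-- Three elements of which the first commutes with the others and is transcendental, and the
other two satisfy the canonical commutation relation, are algebraically independent. -/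
theorem algIndep_of_heisenberg (hS1 : S 0 * S 1 = S 1 * S 0) (hS2 : S 0 * S 2 = S 2 * S 0)
    (hκ : S 1 * S 2 - S 2 * S 1 = algebraMap ℂ R κ) (hκ0 : κ ≠ 0)
    (htr : ∀ q : Polynomial ℂ, Polynomial.aeval (S 0) q = 0 → q = 0) : AlgIndep S := by
  intro P hP
  by_contra hne
  -- Maximality of the total degree in the Heisenberg pair ensures that any other exponent with (m
  -- 1, m 2) ≠ (a, b) has m 1 < a or m 2 < b, so the commutators in `L` kill its monomial.
  obtain ⟨m₀, hm₀, hmax⟩ := P.support.exists_max_image (fun m => m 1 + m 2)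
    (MvPolynomial.support_nonempty.2 hne)
  set a := m₀ 1
  set b := m₀ 2
  let L : R →ₗ[ℂ] R := (commutatorRight (S 1) ^ b) * (commutatorRight (S 2) ^ a)
  let cst : ℂ := (a.factorial * κ ^ a) * (b.factorial * (-κ) ^ b)
  have hcst : cst ≠ 0 := by
    have ha := Nat.cast_ne_zero (R := ℂ) |>.2 a.factorial_ne_zero
    have hb := Nat.cast_ne_zero (R := ℂ) |>.2 b.factorial_ne_zero
    exact mul_ne_zero (mul_ne_zero ha (pow_ne_zero _ hκ0))
      (mul_ne_zero hb (pow_ne_zero _ (neg_ne_zero.2 hκ0)))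
  have hL : ∀ m ∈ P.support, L (symmMonomial S m)
      = if m 1 = a ∧ m 2 = b then
          (((Finsupp.toMultiset m).lists.card : ℂ) * cst) • S 0 ^ m 0 else 0 := by
    intro m hm
    have hw := pow_commutatorRight_lists hS1 hS2 hκ a b
    have hle : m 1 + m 2 ≤ a + b := hmax m hm
    rw [symmMonomial, map_multiset_sum, Multiset.map_map]
    split_ifs with h
    · rw [Multiset.map_congr rfl (g := fun _ => cst • S 0 ^ m 0), Multiset.map_const',
        Multiset.sum_replicate, ← Nat.cast_smul_eq_nsmul ℂ, smul_smul]
      intro l hl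
      have hc := count_of_mem_lists hl
      rw [← hc 0]
      exact (hw l).2 ((hc 1).trans h.1) ((hc 2).trans h.2)
    · rw [Multiset.map_congr rfl (g := fun _ => 0), Multiset.map_const',
        Multiset.sum_replicate, smul_zero]
      intro l hl
      have hc := count_of_mem_lists hl
      refine (hw l).1 ?_
      rw [hc 1, hc 2]
      omega
  -- What `L` leaves is a polynomial in `S 0`. The surviving exponents differ only in m 0, so their
  -- coefficients cannot cancel.
  let q : Polynomial ℂ := ∑ m ∈ P.support, if m 1 = a ∧ m 2 = b then
    Polynomial.monomial (m 0) (P.coeff m * (((Finsupp.toMultiset m).lists.card : ℂ) * cst)) else 0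
  have hq : Polynomial.aeval (S 0) q = 0 := by
    rw [map_sum, ← map_zero L, ← hP, symmEval, map_sum]
    refine Finset.sum_congr rfl fun m hm => ?_
    rw [map_smul, hL m hm]
    split_ifs with h
    · rw [Polynomial.aeval_monomial, smul_smul, Algebra.smul_def]
    · rw [map_zero, smul_zero]
  have hq0 := congrArg (fun q : Polynomial ℂ => q.coeff (m₀ 0)) (htr q hq)
  simp only [q, Polynomial.finsetSum_coeff, Polynomial.coeff_zero] at hq0
  rw [Finset.sum_eq_single_of_mem m₀ hm₀] at hq0
  · rw [if_pos ⟨rfl, rfl⟩, Polynomial.coeff_monomial, if_pos rfl] at hq0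
    exact mul_ne_zero (MvPolynomial.mem_support_iff.1 hm₀)
      (mul_ne_zero (Nat.cast_ne_zero.2 (lists_card_ne_zero m₀)) hcst) hq0
  · intro m _ hm
    split_ifs with h
    · rw [Polynomial.coeff_monomial, if_neg]
      intro h0
      refine hm (Finsupp.ext fun i => ?_)
      fin_cases i
      exacts [h0, h.1, h.2]
    · simp

end Heisenberg

section Transcendence

theorem Dy_formH {S : Type*} [CommRing S] [Algebra ℂ S] {X Y : Derivation ℂ S S} {w y : S}
    (hXY : ∀ f, X (Y f) = Y (X f)) (hYw : Y w = 0) (hYy : Y y = 1) (k a : ℂ) (f : S) :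
    Y (formH X Y k a w y f) = formH X Y k a w y (Y f) + (a • w ^ 2) * f := by
  simp only [formH, map_add, Derivation.map_smul, Derivation.leibniz, Derivation.leibniz_pow,
    hXY, hYw, hYy, smul_eq_mul, smul_zero, mul_zero, add_zero, mul_one]
  simp only [Algebra.smul_def]
  ring

theorem pow_succ_mul_of_mul_eq {R : Type*} [Ring R] {T A G : R} (hA : T * A = A * T + G)
    (hG : T * G = G * T) (n : ℕ) :
    T ^ (n + 1) * A = A * T ^ (n + 1) + (n + 1) • (G * T ^ n) := by
  induction n with
  | zero => simpa using hA
  | succ n ih =>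
    rw [pow_succ' T (n + 1), mul_assoc, ih, mul_add, ← mul_assoc, hA, mul_smul_comm, ← mul_assoc T,
      hG, mul_assoc G, ← pow_succ', add_mul, mul_assoc, add_assoc, succ_nsmul' _ (n + 1)]

/-- The potential is linear in y, so [∂ᵧ, H] is multiplication by α x^{-2/3}, which in turn commutes
with ∂ᵧ. -/
theorem dy_mul_opH (ħ α : ℝ) : dy regularPlane * opH ħ α
    = opH ħ α * dy regularPlane + mulEnd ((α : ℂ) • invCbrtX le_rfl ^ 2) :=
  LinearMap.ext fun f => by
    simp only [Module.End.mul_apply, LinearMap.add_apply, mulEnd_apply, opH_apply, dy_apply]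
    exact Dy_formH (X := Dx regularPlane) Dx_Dy (Dy_invCbrtX le_rfl) Dy_coordY _ _ f

theorem dy_pow_opH (ħ α : ℝ) (f : Smooth regularPlane) (n : ℕ) :
    (dy regularPlane ^ (n + 1)) (opH ħ α f) = opH ħ α ((dy regularPlane ^ (n + 1)) f)
      + (n + 1) • (((α : ℂ) • invCbrtX le_rfl ^ 2) * (dy regularPlane ^ n) f) := by
  have hg : Dy regularPlane ((α : ℂ) • invCbrtX le_rfl ^ 2) = 0 := by
    rw [Derivation.map_smul, Derivation.leibniz_pow, Dy_invCbrtX, smul_zero, smul_zero,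
      smul_zero]
  have h := dy_mul_mulEnd (U := regularPlane) ((α : ℂ) • invCbrtX le_rfl ^ 2)
  rw [hg, show mulEnd (0 : Smooth regularPlane) = 0 from LinearMap.ext fun f => zero_mul f,
    zero_add] at h
  have h2 := pow_succ_mul_of_mul_eq (R := Module.End ℂ (Smooth regularPlane))
    (dy_mul_opH ħ α) h n
  exact LinearMap.congr_fun h2 f

/-- Hⁿ1 is a polynomial in y of degree n, since each factor H raises the y-degree by one through the
potential. This records its leading coefficient. -/
theorem dy_pow_opH_pow_one (ħ α : ℝ) (n : ℕ) :
    (∀ m, n < m → (dy regularPlane ^ m) ((opH ħ α ^ n) 1) = 0) ∧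
    (dy regularPlane ^ n) ((opH ħ α ^ n) 1)
      = (n.factorial : ℂ) • ((α : ℂ) • invCbrtX le_rfl ^ 2) ^ n := by
  induction n with
  | zero =>
    refine ⟨fun m hm => ?_, by simp⟩
    obtain ⟨k, rfl⟩ := Nat.exists_eq_succ_of_ne_zero (Nat.ne_of_gt hm)
    rw [Nat.succ_eq_add_one, pow_succ, Module.End.mul_apply, pow_zero, Module.End.one_apply,
      dy_apply, Derivation.map_one_eq_zero, map_zero]
  | succ n ih =>
    rw [pow_succ' (opH ħ α), Module.End.mul_apply]
    refine ⟨fun m hm => ?_, ?_⟩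
    · obtain ⟨k, rfl⟩ := Nat.exists_eq_succ_of_ne_zero (Nat.ne_of_gt (Nat.zero_lt_of_lt hm))
      rw [Nat.succ_eq_add_one, dy_pow_opH, ih.1 _ (by omega), ih.1 _ (by omega), map_zero,
        mul_zero, smul_zero, add_zero]
    · rw [dy_pow_opH, ih.1 _ (by omega), ih.2, map_zero, zero_add, mul_smul_comm,
        ← Nat.cast_smul_eq_nsmul ℂ, smul_smul, ← pow_succ', Nat.factorial_succ, Nat.cast_mul]

/-- Applying q(H) to 1 and differentiating deg q times in y isolates the leading coefficient of q,
times a nowhere vanishing function. -/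
theorem opH_transcendental (ħ : ℝ) {α : ℝ} (hα : α ≠ 0) (q : Polynomial ℂ)
    (hq : Polynomial.aeval (opH ħ α) q = 0) : q = 0 := by
  obtain ⟨z⟩ := regularPlane_nonempty
  by_contra hne
  have h1 := congrArg (fun f => (dy regularPlane ^ q.natDegree) f) (LinearMap.congr_fun hq 1)
  rw [Polynomial.aeval_eq_sum_range, Finset.sum_range_succ] at h1
  simp only [LinearMap.add_apply, LinearMap.sum_apply, LinearMap.smul_apply, map_add, map_sum,
    map_smul, LinearMap.zero_apply, map_zero] at h1
  rw [Finset.sum_eq_zero, zero_add, (dy_pow_opH_pow_one ħ α _).2] at h1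
  · have h2 := congrArg (eval z) h1
    simp only [map_smul, map_pow, eval_invCbrtX, smul_eq_mul, map_zero] at h2
    have hz : (cbrt z.1.1 : ℂ) ≠ 0 := Complex.ofReal_ne_zero.2 (cbrt_ne_zero z.2)
    have hα' : (α : ℂ) ≠ 0 := Complex.ofReal_ne_zero.2 hα
    exact mul_ne_zero (Polynomial.leadingCoeff_ne_zero.2 hne)
      (mul_ne_zero (Nat.cast_ne_zero.2 (Nat.factorial_ne_zero _))
        (pow_ne_zero _ (mul_ne_zero hα' (pow_ne_zero _ (inv_ne_zero hz))))) h2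
  · intro i hi
    rw [(dy_pow_opH_pow_one ħ α i).1 _ (Finset.mem_range.1 hi), smul_zero]

end Transcendence

theorem isSuperintegrable_ops {ħ α : ℝ} (hħ : 0 < ħ) (hα : α ≠ 0) :
    IsSuperintegrable ![opH ħ α, opX ħ α, opY ħ α] where
  finite_order j := by
    fin_cases j
    exacts [⟨2, opH_mem_diffOps ħ α⟩, ⟨3, opX_mem_diffOps ħ α⟩, ⟨4, opY_mem_diffOps ħ α⟩]
  commute j := by
    fin_cases j
    exacts [sub_self _, sub_eq_zero_of_eq (opH_opX_comm ħ α),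
      sub_eq_zero_of_eq (opH_opY_comm ħ α)]
  algIndep := algIndep_of_heisenberg (opH_opX_comm ħ α) (opH_opY_comm ħ α) (opX_opY_comm ħ α)
    (mul_ne_zero (mul_ne_zero (by norm_num) (neg_I_mul_ne_zero hħ))
      (pow_ne_zero 3 (Complex.ofReal_ne_zero.2 hα))) (opH_transcendental ħ hα)

end QuantumPlane
end

/-! ### Polynomial identities along parameters; the Levi-Civita condition -/

noncomputable section
namespace QuantumPlane

section PolynomialVanishing
open MvPolynomial

theorem totalDegree_pderiv_lt {σ : Type*} [DecidableEq σ] {i : σ} {p : MvPolynomial σ ℂ}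
    (h : pderiv i p ≠ 0) : (pderiv i p).totalDegree < p.totalDegree := by
  obtain ⟨m, hm, hmd⟩ := Finset.exists_mem_eq_sup _
    (support_nonempty.2 h) fun s => s.sum fun _ e => e
  have hm' : m + Finsupp.single i 1 ∈ p.support := by
    rw [mem_support_iff, coeff_pderiv] at hm
    exact mem_support_iff.2 (left_ne_zero_of_mul hm)
  have hle := le_totalDegree hm'
  rw [Finsupp.sum_add_index' (by simp) (by simp), Finsupp.sum_single_index rfl] at hle
  rw [totalDegree, hmd]
  omega

theorem eq_C_of_pderiv_eq_zero {σ : Type*} [DecidableEq σ] {p : MvPolynomial σ ℂ}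
    (h : ∀ i, pderiv i p = 0) : p = C (coeff 0 p) := by
  ext m
  rw [coeff_C]
  split_ifs with hm
  · rw [hm]
  · obtain ⟨i, hi⟩ := Finsupp.ne_iff.1 (Ne.symm hm)
    have hi' : 1 ≤ m i := Nat.one_le_iff_ne_zero.2 hi
    have h1 := congrArg (coeff (m - Finsupp.single i 1)) (h i)
    rw [coeff_pderiv, tsub_add_cancel_of_le (Finsupp.single_le_iff.2 hi'), coeff_zero] at h1
    refine (mul_eq_zero.1 h1).resolve_right ?_
    exact Nat.cast_add_one_ne_zero _

/-- A property of complex polynomials that is stable under partial derivatives and that no nonzero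
constant has is satisfied by the zero polynomial only. -/
theorem eq_zero_of_pderiv_stable {σ : Type*} [DecidableEq σ] {p : MvPolynomial σ ℂ → Prop}
    (hp : ∀ q i, p q → p (pderiv i q)) (hC : ∀ c, p (C c) → c = 0) :
    ∀ q, p q → q = 0 := by
  have main : ∀ n q, q.totalDegree < n → p q → q = 0 := by
    intro n
    induction n with
    | zero => intro q hq; omega
    | succ n ih =>
      intro q hq hpq
      have hd : ∀ i, pderiv i q = 0 := fun i => by
        by_contra h
        exact h (ih _ (by have := totalDegree_pderiv_lt h; omega) (hp q i hpq))
      have hq' := eq_C_of_pderiv_eq_zero hd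
      rw [hq'] at hpq
      rw [hq', hC _ hpq, map_zero]
  exact fun q => main _ q (Nat.lt_succ_self _)

variable {ι E : Type*} [Fintype ι] [DecidableEq ι] [NormedAddCommGroup E] [NormedSpace ℝ E]

theorem hasFDerivAt_eval {F : E → ι → ℂ} {F' : ι → E →L[ℝ] ℂ} {c : E}
    (hF : ∀ i, HasFDerivAt (fun c => F c i) (F' i) c) (p : MvPolynomial ι ℂ) :
    HasFDerivAt (fun c => eval (F c) p) (∑ i, eval (F c) (pderiv i p) • F' i) c := by
  induction p using MvPolynomial.induction_on with
  | C a =>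
    simp only [eval_C]
    refine (hasFDerivAt_const a c).congr_fderiv (ContinuousLinearMap.ext fun v => ?_)
    simp
  | add p q hp hq =>
    simp only [eval_add]
    refine (hp.add hq).congr_fderiv (ContinuousLinearMap.ext fun v => ?_)
    simp [add_mul, Finset.sum_add_distrib]
  | mul_X p j hp =>
    simp only [eval_mul, eval_X]
    refine (hp.mul (hF j)).congr_fderiv (ContinuousLinearMap.ext fun v => ?_)
    simp [pderiv_X, Pi.single_apply, apply_ite, add_mul, Finset.sum_add_distrib, Finset.mul_sum,
      mul_assoc]

/-- A complex polynomial that vanishes along a map from an open set of real parameters whose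
complex Jacobian determinant does not vanish is zero. -/
theorem eq_zero_of_eval_eq_zero {n : ℕ} {C : Set (Fin n → ℝ)} (hC : IsOpen C) (hne : C.Nonempty)
    (F : (Fin n → ℝ) → Fin n → ℂ)
    (hdet : ∀ c ∈ C, (Matrix.of fun i j : Fin n =>
      fderiv ℝ (fun c' => F c' i) c (Pi.single j 1)).det ≠ 0)
    (p : MvPolynomial (Fin n) ℂ) (hp : ∀ c ∈ C, eval (F c) p = 0) : p = 0 := by
  refine eq_zero_of_pderiv_stable (p := fun p => ∀ c ∈ C, eval (F c) p = 0) ?_ ?_ p hp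
  · intro q i hq c hc
    have hd : ∀ i, DifferentiableAt ℝ (fun c' => F c' i) c := by
      intro i
      by_contra h
      -- At a point of non-differentiability `fderiv` is zero by convention, so a row would vanish;
      -- the determinant condition thus includes differentiability.
      refine hdet c hc (Matrix.det_eq_zero_of_row_eq_zero i fun j => ?_)
      rw [Matrix.of_apply, fderiv_zero_of_not_differentiableAt h]
      rfl
    have h1 := hasFDerivAt_eval (fun i => (hd i).hasFDerivAt) q
    have h2 : HasFDerivAt (fun c => eval (F c) q) (0 : (Fin n → ℝ) →L[ℝ] ℂ) c :=
      (hasFDerivAt_const (0 : ℂ) c).congr_of_eventuallyEq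
        (Filter.eventually_of_mem (hC.mem_nhds hc) hq)
    have h3 := h1.unique h2
    -- By the chain rule the vector of values (∂ᵢq)(F c) is in the left kernel of the Jacobian
    -- matrix.
    have h4 := Matrix.eq_zero_of_vecMul_eq_zero (hdet c hc)
      (v := fun i => eval (F c) (pderiv i q)) (by
        funext j
        have := congrArg (fun L : (Fin n → ℝ) →L[ℝ] ℂ => L (Pi.single j 1)) h3
        simpa [Matrix.vecMul, dotProduct, sum_apply, smul_apply] using this)
    exact congrFun h4 i
  · intro a ha
    obtain ⟨c, hc⟩ := hne
    simpa using ha c hc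

end PolynomialVanishing

section LeviCivita

/-- The jet `(f, D₁f, D₂f, D₂D₁f)`. -/
def mixedJet {A : Type*} [CommRing A] [Algebra ℂ A] (D₁ D₂ : Derivation ℂ A A) (f : A) :
    Fin 4 → A := ![f, D₁ f, D₂ f, D₂ (D₁ f)]

/-- The Levi-Civita type compatibility expression of the separated equation
`P a₂ + 2 R a₁ b₁ + Q b₂ + p a₁ + q b₁ + w = const`, in terms of the mixed jets of its coefficients
and the values of `a₁, a₂, b₁, b₂`. -/
def leviCivita {A : Type*} [CommRing A] (P R Q p q w : Fin 4 → A) (a₁ a₂ b₁ b₂ : A) : A :=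
  Q 0 * (P 0 * (P 3 * a₂ + 2 * R 3 * a₁ * b₁ + 2 * R 1 * a₁ * (b₂ - b₁ ^ 2)
      + 2 * R 2 * (a₂ - a₁ ^ 2) * b₁ + 2 * R 0 * (a₂ - a₁ ^ 2) * (b₂ - b₁ ^ 2)
      + Q 3 * b₂ + p 3 * a₁ + p 2 * (a₂ - a₁ ^ 2) + q 3 * b₁ + q 1 * (b₂ - b₁ ^ 2) + w 3)
    - P 2 * (P 1 * a₂ + 2 * R 1 * a₁ * b₁ + 2 * R 0 * (a₂ - a₁ ^ 2) * b₁ + Q 1 * b₂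
      + p 1 * a₁ + p 0 * (a₂ - a₁ ^ 2) + q 1 * b₁ + w 1))
    - P 0 * Q 1 * (P 2 * a₂ + 2 * R 2 * a₁ * b₁ + 2 * R 0 * a₁ * (b₂ - b₁ ^ 2) + Q 2 * b₂
      + p 2 * a₁ + q 2 * b₁ + q 0 * (b₂ - b₁ ^ 2) + w 2)

/-- The same expression is used over smooth functions, over ℂ after evaluation at a point, and over
a polynomial ring with a₁, a₂, b₁, b₂ as indeterminates. -/
theorem map_leviCivita {A B G : Type*} [CommRing A] [CommRing B] [FunLike G A B]
    [RingHomClass G A B] (e : G) (P R Q p q w : Fin 4 → A) (a₁ a₂ b₁ b₂ : A) :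
    e (leviCivita P R Q p q w a₁ a₂ b₁ b₂)
      = leviCivita (e ∘ P) (e ∘ R) (e ∘ Q) (e ∘ p) (e ∘ q) (e ∘ w) (e a₁) (e a₂) (e b₁) (e b₂) := by
  simp only [leviCivita, map_add, map_sub, map_mul, map_pow, map_ofNat, Function.comp_apply]

/-- The D₁-derivative of the separated equation contains a₃ with coefficient P, the D₂-derivative
contains b₃ with coefficient Q, and the mixed one contains (D₂P) a₃ + (D₁Q) b₃. The combination PQ ·
(mixed) - Q(D₂P) · (first) - P(D₁Q) · (second) eliminates both. -/
theorem leviCivita_eq_zero {A : Type*} [CommRing A] [Algebra ℂ A] {D₁ D₂ : Derivation ℂ A A}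
    {P R Q p q w a₁ a₂ a₃ b₁ b₂ b₃ : A} {E : ℂ}
    (h : P * a₂ + 2 * R * a₁ * b₁ + Q * b₂ + p * a₁ + q * b₁ + w = algebraMap ℂ A E)
    (h₁a₁ : D₁ a₁ = a₂ - a₁ ^ 2) (h₁a₂ : D₁ a₂ = a₃) (h₂a₁ : D₂ a₁ = 0) (h₂a₂ : D₂ a₂ = 0)
    (h₂a₃ : D₂ a₃ = 0) (h₁b₁ : D₁ b₁ = 0) (h₁b₂ : D₁ b₂ = 0) (h₂b₁ : D₂ b₁ = b₂ - b₁ ^ 2)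
    (h₂b₂ : D₂ b₂ = b₃) :
    leviCivita (mixedJet D₁ D₂ P) (mixedJet D₁ D₂ R) (mixedJet D₁ D₂ Q) (mixedJet D₁ D₂ p)
      (mixedJet D₁ D₂ q) (mixedJet D₁ D₂ w) a₁ a₂ b₁ b₂ = 0 := by
  have h2 (D : Derivation ℂ A A) : D (2 : A) = 0 := D.map_natCast 2
  have e1 := congrArg D₁ h
  have e2 := congrArg D₂ h
  simp only [map_add, Derivation.leibniz, smul_eq_mul, h2,
    Derivation.map_algebraMap, h₁a₁, h₁a₂, h₂a₁, h₂a₂, h₁b₁, h₁b₂, h₂b₁, h₂b₂, mul_zero,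
    add_zero, zero_add] at e1 e2
  have e3 := congrArg D₂ e1
  simp only [map_add, map_sub, map_zero, Derivation.leibniz, Derivation.leibniz_pow, smul_eq_mul,
    h2, h₂a₁, h₂a₂, h₂a₃, h₂b₁, h₂b₂, mul_zero, add_zero, zero_add, smul_zero, sub_zero] at e3
  simp only [leviCivita, mixedJet, Matrix.cons_val]
  linear_combination Q * P * e3 - Q * D₂ P * e1 - P * D₁ Q * e2

variable {P R Q p q w : Fin 4 → ℂ}

/-- The coefficient of a₁²b₁² is 2PQR; second differences at ±1 in a₁ and b₁ extract it. Hence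
separation forces orthogonal coordinates. -/
theorem mixed_coeff_eq_zero (h : ∀ a₁ a₂ b₁ b₂, leviCivita P R Q p q w a₁ a₂ b₁ b₂ = 0)
    (hP : P 0 ≠ 0) (hQ : Q 0 ≠ 0) : R 0 = 0 := by
  have : Q 0 * P 0 * R 0 = 0 := by
    have h1 := h 1 0 1 0
    have h2 := h 1 0 (-1) 0
    have h3 := h (-1) 0 1 0
    have h4 := h (-1) 0 (-1) 0
    have h5 := h 1 0 0 0
    have h6 := h (-1) 0 0 0
    have h7 := h 0 0 1 0
    have h8 := h 0 0 (-1) 0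
    have h9 := h 0 0 0 0
    simp only [leviCivita] at h1 h2 h3 h4 h5 h6 h7 h8 h9
    linear_combination (h1 + h2 + h3 + h4 - 2 * h5 - 2 * h6 - 2 * h7 - 2 * h8 + 4 * h9) / 8
  exact (mul_eq_zero.1 this).resolve_left (mul_ne_zero hQ hP)

/-- Adding the coefficients of a₂ and a₁² cancels the first-order terms p and leaves the condition
on P; likewise for b₂, b₁² and Q. The constant term is the condition on the potential. -/
theorem stackel_of_leviCivita (h : ∀ a₁ a₂ b₁ b₂, leviCivita P 0 Q p q w a₁ a₂ b₁ b₂ = 0) :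
    Q 0 * (P 0 * P 3 - P 1 * P 2) = P 0 * (Q 1 * P 2) ∧
    P 0 * (Q 0 * Q 3 - Q 1 * Q 2) = Q 0 * (Q 1 * P 2) ∧
    P 0 * Q 0 * w 3 = Q 0 * P 2 * w 1 + P 0 * Q 1 * w 2 := by
  have h0 := h 0 0 0 0
  have ha := h 1 0 0 0
  have ha' := h (-1) 0 0 0
  have hb := h 0 0 1 0
  have hb' := h 0 0 (-1) 0
  have h2 := h 0 1 0 0
  have h3 := h 0 0 0 1
  simp only [leviCivita, Pi.zero_apply] at h0 ha ha' hb hb' h2 h3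
  refine ⟨?_, ?_, ?_⟩
  · linear_combination h2 - h0 + (ha + ha') / 2 - h0
  · linear_combination h3 - h0 + (hb + hb') / 2 - h0
  · linear_combination h0

end LeviCivita

end QuantumPlane
end

/-! ### Curvilinear coordinates, Killing tensors and the Bertrand-Darboux equation -/

noncomputable section
namespace QuantumPlane
open Smooth

theorem Smooth.isUnit_iff {U : Opens (ℝ × ℝ)} {f : Smooth U} : IsUnit f ↔ ∀ z, eval z f ≠ 0 := by
  refine ⟨fun h z => (h.map (eval z)).ne_zero, fun h => ?_⟩
  obtain ⟨g, hg⟩ := exists_mul_eq_one f h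
  exact IsUnit.of_mul_eq_one g hg

theorem Smooth.algebraMap_eq_zero {U : Opens (ℝ × ℝ)} (z : U) {c : ℂ}
    (h : algebraMap ℂ (Smooth U) c = 0) : c = 0 := by
  have := congrArg (eval z) h
  rwa [AlgHom.commutes, map_zero] at this

theorem derivation_of_mul_eq_one {A : Type*} [CommRing A] [Algebra ℂ A] {f g : A}
    (D : Derivation ℂ A A) (hfg : f * g = 1) : D g = -g ^ 2 * D f := by
  have h := congrArg D hfg
  simp only [Derivation.leibniz, Derivation.map_one_eq_zero, smul_eq_mul] at h
  linear_combination g * h - D g * hfg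

section CurvilinearCoordinates
variable {U : Opens (ℝ × ℝ)}

/-- The Jacobian determinant of a pair of functions. -/
def jacobian (u v : Smooth U) : Smooth U := Dx U u * Dy U v - Dy U u * Dx U v

/-- `∂/∂u` in the coordinates `(u, v)`, where `j` is the inverse of their Jacobian determinant. -/
def partialU (j v : Smooth U) : Derivation ℂ (Smooth U) (Smooth U) :=
  j • (Dy U v • Dx U - Dx U v • Dy U)

/-- `∂/∂v` in the coordinates `(u, v)`, where `j` is the inverse of their Jacobian determinant. -/
def partialV (j u : Smooth U) : Derivation ℂ (Smooth U) (Smooth U) :=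
  j • (Dx U u • Dy U - Dy U u • Dx U)

theorem partialU_apply (j v f : Smooth U) :
    partialU j v f = j * (Dy U v * Dx U f - Dx U v * Dy U f) := rfl

theorem partialV_apply (j u f : Smooth U) :
    partialV j u f = j * (Dx U u * Dy U f - Dy U u * Dx U f) := rfl

variable {u v j : Smooth U} (hj : jacobian u v * j = 1)
include hj

theorem partialU_u : partialU j v u = 1 := by
  rw [jacobian] at hj; rw [partialU_apply]; linear_combination hj

theorem partialV_v : partialV j u v = 1 := by
  rw [jacobian] at hj; rw [partialV_apply]; linear_combination hj

theorem Dx_eq (f : Smooth U) :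
    Dx U f = partialU j v f * Dx U u + partialV j u f * Dx U v := by
  rw [jacobian] at hj; rw [partialU_apply, partialV_apply]; linear_combination -Dx U f * hj

theorem Dy_eq (f : Smooth U) :
    Dy U f = partialU j v f * Dy U u + partialV j u f * Dy U v := by
  rw [jacobian] at hj; rw [partialU_apply, partialV_apply]; linear_combination -Dy U f * hj

/-- The formula d(g du + h dv) = (∂ᵤh - ∂ᵥg) du ∧ dv, read in the coordinates (x, y) with reversed
sign. With g du + h dv = df it shows that ∂ᵤ and ∂ᵥ commute. -/
theorem exterior_derivative_eq (g h : Smooth U) :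
    Dy U (g * Dx U u + h * Dx U v) - Dx U (g * Dy U u + h * Dy U v)
      = jacobian u v * (partialV j u g - partialU j v h) := by
  simp only [map_add, Derivation.leibniz, smul_eq_mul, Dx_Dy, partialU_apply, partialV_apply]
  rw [jacobian] at hj ⊢
  linear_combination
    -(Dx U u * Dy U g - Dy U u * Dx U g - Dy U v * Dx U h + Dx U v * Dy U h) * hj

theorem partialV_partialU (f : Smooth U) :
    partialV j u (partialU j v f) = partialU j v (partialV j u f) := by
  have h := exterior_derivative_eq hj (partialU j v f) (partialV j u f)
  rw [← Dx_eq hj, ← Dy_eq hj, Dx_Dy, sub_self] at h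
  linear_combination -j * h - (partialV j u (partialU j v f) - partialU j v (partialV j u f)) * hj

/-- Convexity is needed in (x, y) only, because the form g du + h dv is integrated in Cartesian
coordinates; the image of `U` under (u, v) may have any shape. -/
theorem exists_primitive_coord (hU : Convex ℝ (U : Set (ℝ × ℝ))) {g h : Smooth U}
    (hgh : partialV j u g = partialU j v h) :
    ∃ F, partialU j v F = g ∧ partialV j u F = h := by
  have h1 := exterior_derivative_eq hj g h
  rw [hgh, sub_self, mul_zero, sub_eq_zero] at h1
  obtain ⟨F, hFx, hFy⟩ := exists_primitive_of_convex hU _ _ h1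
  rw [jacobian] at hj
  refine ⟨F, ?_, ?_⟩
  · rw [partialU_apply, hFx, hFy]; linear_combination g * hj
  · rw [partialV_apply, hFx, hFy]; linear_combination h * hj

end CurvilinearCoordinates

section Killing
variable {U : Opens (ℝ × ℝ)}

/-- The equations of a Killing tensor of the Euclidean plane. -/
structure IsKilling (K₁₁ K₁₂ K₂₂ : Smooth U) : Prop where
  xxx : Dx U K₁₁ = 0
  xxy : Dy U K₁₁ + 2 * Dx U K₁₂ = 0
  xyy : Dx U K₂₂ + 2 * Dy U K₁₂ = 0
  yyy : Dy U K₂₂ = 0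

local notation "𝒞" => algebraMap ℂ (Smooth U)

/-- A Killing tensor on a convex open set of the plane is a quadratic polynomial. -/
theorem IsKilling.exists_polynomial (hU : Convex ℝ (U : Set (ℝ × ℝ))) {K₁₁ K₁₂ K₂₂ : Smooth U}
    (h : IsKilling K₁₁ K₁₂ K₂₂) : ∃ a b₁ b₂ c₁ c₂ c : ℂ,
      K₁₁ = 𝒞 a * coordY U ^ 2 + 2 * 𝒞 b₁ * coordY U + 𝒞 c₁ ∧
      K₁₂ = -𝒞 a * coordX U * coordY U - 𝒞 b₁ * coordX U - 𝒞 b₂ * coordY U + 𝒞 c ∧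
      K₂₂ = 𝒞 a * coordX U ^ 2 + 2 * 𝒞 b₂ * coordX U + 𝒞 c₂ := by
  have h2 (D : Derivation ℂ (Smooth U) (Smooth U)) (f) : D (2 * f) = 2 * D f := by
    rw [two_mul, map_add, two_mul]
  have e1 : Dy U (Dy U K₁₁) + 2 * Dy U (Dx U K₁₂) = 0 := by
    rw [← h2, ← map_add, h.xxy, map_zero]
  have e2 : Dx U (Dx U K₂₂) + 2 * Dy U (Dx U K₁₂) = 0 := by
    rw [← Dx_Dy, ← h2, ← map_add, h.xyy, map_zero]
  -- The left side does not depend on x and the right side does not depend on y, so their common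
  -- value is a constant, 2a.
  have e3 : Dy U (Dy U K₁₁) = Dx U (Dx U K₂₂) := by linear_combination e1 - e2
  obtain ⟨k, hk⟩ := eq_algebraMap_of_convex hU (Dy U (Dy U K₁₁))
    (by rw [Dx_Dy, Dx_Dy, h.xxx, map_zero, map_zero])
    (by rw [e3, ← Dx_Dy, ← Dx_Dy, h.yyy, map_zero, map_zero])
  have hk' : 𝒞 k = 2 * 𝒞 (k / 2) := by
    rw [← map_ofNat 𝒞 2, ← map_mul]; congr 1; ring
  set a := k / 2
  obtain ⟨k₁, hk₁⟩ := eq_algebraMap_of_convex hU (Dy U K₁₁ - 2 * (𝒞 a * coordY U))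
    (by simp [Dx_Dy, h.xxx, h2])
    (by simp [hk, hk', h2])
  obtain ⟨k₂, hk₂⟩ := eq_algebraMap_of_convex hU (Dx U K₂₂ - 2 * (𝒞 a * coordX U))
    (by simp [← e3, hk, hk', h2])
    (by simp [← Dx_Dy, h.yyy, h2])
  have hk₁' : 𝒞 k₁ = 2 * 𝒞 (k₁ / 2) := by
    rw [← map_ofNat 𝒞 2, ← map_mul]; congr 1; ring
  have hk₂' : 𝒞 k₂ = 2 * 𝒞 (k₂ / 2) := by
    rw [← map_ofNat 𝒞 2, ← map_mul]; congr 1; ring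
  have hcancel : ∀ {f : Smooth U}, 2 * f = 0 → f = 0 := fun {f} hf => by
    have h' : (2 : ℂ) • f = 0 := by rw [Algebra.smul_def, map_ofNat, hf]
    exact (smul_eq_zero.1 h').resolve_left two_ne_zero
  obtain ⟨c₁, hc₁⟩ := eq_algebraMap_of_convex hU
    (K₁₁ - 𝒞 a * coordY U ^ 2 - 2 * (𝒞 (k₁ / 2) * coordY U))
    (by simp [h.xxx, h2, Derivation.leibniz_pow])
    (by
      simp only [map_sub, Derivation.leibniz, Derivation.leibniz_pow, h2,
        Derivation.map_algebraMap, Dy_coordY, smul_eq_mul]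
      simp
      linear_combination hk₁ + hk₁')
  obtain ⟨c₂, hc₂⟩ := eq_algebraMap_of_convex hU
    (K₂₂ - 𝒞 a * coordX U ^ 2 - 2 * (𝒞 (k₂ / 2) * coordX U))
    (by
      simp only [map_sub, Derivation.leibniz, Derivation.leibniz_pow, h2,
        Derivation.map_algebraMap, Dx_coordX, smul_eq_mul]
      simp
      linear_combination hk₂ + hk₂')
    (by simp [h.yyy, h2, Derivation.leibniz_pow])
  obtain ⟨c, hc⟩ := eq_algebraMap_of_convex hU
    (K₁₂ + 𝒞 a * (coordX U * coordY U) + 𝒞 (k₁ / 2) * coordX U + 𝒞 (k₂ / 2) * coordY U)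
    (hcancel (by
      simp only [map_add, Derivation.leibniz, Derivation.map_algebraMap, Dx_coordX, Dx_coordY,
        smul_eq_mul]
      linear_combination h.xxy - hk₁ - hk₁'))
    (hcancel (by
      simp only [map_add, Derivation.leibniz, Derivation.map_algebraMap, Dy_coordX, Dy_coordY,
        smul_eq_mul]
      linear_combination h.xyy - hk₂ - hk₂'))
  exact ⟨a, k₁ / 2, k₂ / 2, c₁, c₂, c, by linear_combination hc₁, by linear_combination hc,
    by linear_combination hc₂⟩

/-- The Bertrand-Darboux equation: `K dV` is a closed form. -/
def BertrandDarboux (K₁₁ K₁₂ K₂₂ V : Smooth U) : Prop :=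
  Dx U (K₁₂ * Dx U V + K₂₂ * Dy U V) = Dy U (K₁₁ * Dx U V + K₁₂ * Dy U V)

theorem eq_zero_of_quadratic_coordY {A B C : Smooth U} (hA : Dy U A = 0) (hB : Dy U B = 0)
    (hC : Dy U C = 0) (h : A * coordY U ^ 2 + B * coordY U + C = 0) : A = 0 ∧ B = 0 ∧ C = 0 := by
  have h1 := congrArg (Dy U) h
  simp only [map_add, Derivation.leibniz, Derivation.leibniz_pow, hA, hB, hC, Dy_coordY,
    smul_eq_mul, map_zero, Nat.reduceSub, pow_one, mul_zero, mul_one, add_zero] at h1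
  have h2 := congrArg (Dy U) h1
  simp only [map_add, map_nsmul, Derivation.leibniz, hA, hB, Dy_coordY, smul_eq_mul, map_zero,
    mul_zero, add_zero] at h2
  have hA0 : A = 0 := by
    have h' : (2 : ℂ) • A = 0 := by
      rw [Algebra.smul_def, map_ofNat]
      linear_combination h2
    exact (smul_eq_zero.1 h').resolve_left two_ne_zero
  have hB0 : B = 0 := by rw [hA0] at h1; linear_combination h1
  exact ⟨hA0, hB0, by rw [hA0, hB0] at h; linear_combination h⟩

theorem eq_zero_of_linear_coordX (z : U) {a b : ℂ} (h : 𝒞 a * coordX U + 𝒞 b = 0) :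
    a = 0 ∧ b = 0 := by
  have h1 := congrArg (Dx U) h
  simp only [map_add, Derivation.leibniz, Derivation.map_algebraMap, Dx_coordX, smul_eq_mul,
    map_zero, mul_zero, mul_one, add_zero] at h1
  have ha := algebraMap_eq_zero z h1
  rw [ha, map_zero, zero_mul, zero_add] at h
  exact ⟨ha, algebraMap_eq_zero z h⟩

variable (hU : U ≤ regularPlane)

/-- After clearing denominators the equation is quadratic in y with coefficients depending on x
alone. As α ≠ 0, the y²-coefficient gives a = b₂ = 0, then the y-coefficient gives b₁ = c = 0, and
the rest gives c₁ = c₂. -/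
theorem bertrandDarboux_rigid (hne : Nonempty U) {α β a b₁ b₂ c₁ c₂ c : ℂ} (hα : α ≠ 0)
    (hBD : BertrandDarboux
      (𝒞 a * coordY U ^ 2 + 2 * 𝒞 b₁ * coordY U + 𝒞 c₁)
      (-𝒞 a * coordX U * coordY U - 𝒞 b₁ * coordX U - 𝒞 b₂ * coordY U + 𝒞 c)
      (𝒞 a * coordX U ^ 2 + 2 * 𝒞 b₂ * coordX U + 𝒞 c₂)
      (𝒞 α * (coordY U * invCbrtX hU ^ 2) + 𝒞 β * invCbrtX hU ^ 6)) :
    a = 0 ∧ b₁ = 0 ∧ b₂ = 0 ∧ c = 0 ∧ c₁ = c₂ := by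
  obtain ⟨z₀⟩ := hne
  have hn (D : Derivation ℂ (Smooth U) (Smooth U)) (n : ℕ) [n.AtLeastTwo] :
    D (OfNat.ofNat n : Smooth U) = 0 := D.map_natCast n
  have ht : IsUnit (cbrtX hU) := IsUnit.of_mul_eq_one _ (cbrtX_mul_invCbrtX hU)
  have hαu : IsUnit (𝒞 α) := (Ne.isUnit hα).map _
  -- The Bertrand-Darboux equation multiplied by 9x⁴.
  have key : 𝒞 α * cbrtX hU ^ 4 * (coordY U ^ 2 * (14 * 𝒞 a * coordX U - 10 * 𝒞 b₂)
      + 10 * coordY U * (2 * 𝒞 b₁ * coordX U + 𝒞 c)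
      + (21 * 𝒞 a * coordX U ^ 3 + 15 * 𝒞 b₂ * coordX U ^ 2 - 6 * (𝒞 c₂ - 𝒞 c₁) * coordX U))
      - 54 * 𝒞 β * (𝒞 b₂ * coordY U - 𝒞 c) = 0 := by
    refine ext_eval fun z => ?_
    have h := congrArg (eval z) hBD
    have h0 : eval z (cbrtX hU) ≠ 0 := isUnit_iff.1 ht z
    have hw : eval z (invCbrtX hU) = (eval z (cbrtX hU))⁻¹ := by
      apply eq_inv_of_mul_eq_one_right
      rw [← map_mul, cbrtX_mul_invCbrtX, map_one]
    have hx : eval z (coordX U) = eval z (cbrtX hU) ^ 3 := by rw [← map_pow, cbrtX_pow_three]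
    simp only [map_add, map_sub, map_neg, Derivation.leibniz, Derivation.leibniz_pow, smul_eq_mul,
      Derivation.map_algebraMap, Dx_coordX, Dx_coordY, Dy_coordX, Dy_coordY, Dx_invCbrtX,
      Dy_invCbrtX, Derivation.map_smul, hn, map_zero, map_mul, map_smul, map_pow, map_ofNat,
      nsmul_eq_mul, AlgHom.commutes, Nat.cast_ofNat, Nat.reduceSub, pow_one,
      mul_zero, add_zero, zero_add, mul_one, smul_zero, neg_zero, sub_zero,
      Algebra.algebraMap_self, RingHom.id_apply] at h ⊢
    rw [hw, hx] at h
    rw [hx]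
    generalize eval z (cbrtX hU) = τ at h h0 ⊢
    field_simp at h
    linear_combination h
  have hC : ∀ {c : ℂ}, Dy U (𝒞 c) = 0 := fun {c} => (Dy U).map_algebraMap c
  obtain ⟨hA, hB, hD⟩ := eq_zero_of_quadratic_coordY
    (A := 𝒞 α * cbrtX hU ^ 4 * (14 * 𝒞 a * coordX U - 10 * 𝒞 b₂))
    (B := 𝒞 α * cbrtX hU ^ 4 * 10 * (2 * 𝒞 b₁ * coordX U + 𝒞 c) - 54 * 𝒞 β * 𝒞 b₂)
    (C := 𝒞 α * cbrtX hU ^ 4 * (21 * 𝒞 a * coordX U ^ 3 + 15 * 𝒞 b₂ * coordX U ^ 2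
      - 6 * (𝒞 c₂ - 𝒞 c₁) * coordX U) + 54 * 𝒞 β * 𝒞 c)
    (by simp [hC, hn, Derivation.leibniz_pow, Dy_cbrtX])
    (by simp [hC, hn, Derivation.leibniz_pow, Dy_cbrtX])
    (by simp [hC, hn, Derivation.leibniz_pow, Dy_cbrtX])
    (by linear_combination key)
  have hu : IsUnit (𝒞 α * cbrtX hU ^ 4) := hαu.mul (ht.pow 4)
  rw [hu.mul_right_eq_zero] at hA
  obtain ⟨ha, hb₂⟩ := eq_zero_of_linear_coordX z₀ (a := 14 * a) (b := -10 * b₂) (by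
    simp only [map_mul, map_neg, map_ofNat]; linear_combination hA)
  have ha : a = 0 := by linear_combination ha / 14
  have hb₂ : b₂ = 0 := by linear_combination -hb₂ / 10
  subst ha hb₂
  rw [map_zero, mul_zero, sub_zero, mul_assoc, hu.mul_right_eq_zero] at hB
  obtain ⟨hb₁, hc⟩ := eq_zero_of_linear_coordX z₀ (a := 20 * b₁) (b := 10 * c) (by
    simp only [map_mul, map_ofNat]; linear_combination hB)
  have hb₁ : b₁ = 0 := by linear_combination hb₁ / 20
  have hc : c = 0 := by linear_combination hc / 10
  subst hb₁ hc
  have hD' : 𝒞 α * cbrtX hU ^ 4 * ((𝒞 (-6 * (c₂ - c₁))) * coordX U + 𝒞 0) = 0 := by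
    simp only [map_mul, map_sub, map_neg, map_ofNat, map_zero] at hD ⊢
    linear_combination hD
  rw [hu.mul_right_eq_zero] at hD'
  have h12 := (eq_zero_of_linear_coordX z₀ hD').1
  exact ⟨rfl, rfl, rfl, rfl, by linear_combination h12 / 6⟩

end Killing

end QuantumPlane
end

/-! ### From the Stäckel conditions to a Killing tensor -/

noncomputable section
namespace QuantumPlane
open Smooth

/-- The scalar product of gradients. -/
def gradInner {U : Opens (ℝ × ℝ)} (u v : Smooth U) : Smooth U :=
  Dx U u * Dx U v + Dy U u * Dy U v

section
variable {a b r s t vx vy vxx vxy vyy : ℂ}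

theorem exists_rotation (hP : a ^ 2 + b ^ 2 ≠ 0) (h : a * vx + b * vy = 0) :
    ∃ m, vx = -m * b ∧ vy = m * a := by
  refine ⟨(a * vy - b * vx) / (a ^ 2 + b ^ 2), ?_, ?_⟩
  · field_simp; linear_combination a * h
  · field_simp; linear_combination b * h

/-- Pointwise, (a, b) = ∇u, and r, s, t are the second derivatives of u. Orthogonality gives ∇v =
m(-b, a), and the differentiated relations `hx`, `hy` eliminate the second derivatives of v. The
scale m then cancels, so everything is expressed by u and δ. -/
theorem log_derivatives_of_orthogonal {δ δ₁ δ₂ l₁ P₂ Q₁ : ℂ} (hP : a ^ 2 + b ^ 2 ≠ 0)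
    (hJ : a * vy - b * vx ≠ 0) (h : a * vx + b * vy = 0)
    (hx : r * vx + a * vxx + (s * vy + b * vxy) = 0)
    (hy : s * vx + a * vxy + (t * vy + b * vyy) = 0)
    (hQ₁ : (a * vy - b * vx) * Q₁ = vy * (2 * (vx * vxx + vy * vxy))
      - vx * (2 * (vx * vxy + vy * vyy)))
    (hP₂ : (a * vy - b * vx) * P₂ = a * (2 * (a * s + b * t)) - b * (2 * (a * r + b * s)))
    (hδ₁ : (vx ^ 2 + vy ^ 2) * δ₁ = -δ * Q₁) (hδ₂ : (a ^ 2 + b ^ 2) * δ₂ = -δ * P₂)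
    (hl₁ : (vx ^ 2 + vy ^ 2) * l₁ = δ * Q₁) :
    l₁ = 2 * δ * (2 * a * b * s - b ^ 2 * r - a ^ 2 * t) / (a ^ 2 + b ^ 2) ^ 2 ∧ δ₁ = -l₁ ∧
    δ₂ * vx = 2 * δ * b * (a * (a * s + b * t) - b * (a * r + b * s)) / (a ^ 2 + b ^ 2) ^ 2 ∧
    δ₂ * vy = -2 * δ * a * (a * (a * s + b * t) - b * (a * r + b * s)) / (a ^ 2 + b ^ 2) ^ 2 := by
  obtain ⟨m, rfl, rfl⟩ := exists_rotation hP h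
  have hm : m ≠ 0 := by
    rintro rfl
    apply hJ; ring
  have hQ₁' : (a ^ 2 + b ^ 2) * Q₁ = 2 * m ^ 2 * (2 * a * b * s - b ^ 2 * r - a ^ 2 * t) :=
    mul_left_cancel₀ hm (by linear_combination hQ₁ - 2 * m ^ 2 * b * hx + 2 * m ^ 2 * a * hy)
  have hP₂' : m * ((a ^ 2 + b ^ 2) * P₂)
      = 2 * (a * (a * s + b * t) - b * (a * r + b * s)) := by linear_combination hP₂
  have hl₁' : l₁ = 2 * δ * (2 * a * b * s - b ^ 2 * r - a ^ 2 * t) / (a ^ 2 + b ^ 2) ^ 2 := by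
    rw [eq_div_iff (pow_ne_zero 2 hP)]
    exact mul_left_cancel₀ (pow_ne_zero 2 hm)
      (by linear_combination (a ^ 2 + b ^ 2) * hl₁ + δ * hQ₁')
  refine ⟨hl₁', ?_, ?_, ?_⟩
  · refine mul_left_cancel₀ (mul_ne_zero (pow_ne_zero 2 hm) hP) ?_
    linear_combination hδ₁ + hl₁
  · rw [eq_div_iff (pow_ne_zero 2 hP)]
    linear_combination (-m * b) * (a ^ 2 + b ^ 2) * hδ₂ + δ * b * hP₂'
  · rw [eq_div_iff (pow_ne_zero 2 hP)]
    linear_combination (m * a) * (a ^ 2 + b ^ 2) * hδ₂ - δ * a * hP₂'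

theorem killing_equations_of_orthogonal {δ δ₁ δ₂ l₁ P₂ Q₁ p : ℂ} (hP : a ^ 2 + b ^ 2 ≠ 0)
    (hJ : a * vy - b * vx ≠ 0) (h : a * vx + b * vy = 0)
    (hx : r * vx + a * vxx + (s * vy + b * vxy) = 0)
    (hy : s * vx + a * vxy + (t * vy + b * vyy) = 0)
    (hQ₁ : (a * vy - b * vx) * Q₁ = vy * (2 * (vx * vxx + vy * vxy))
      - vx * (2 * (vx * vxy + vy * vyy)))
    (hP₂ : (a * vy - b * vx) * P₂ = a * (2 * (a * s + b * t)) - b * (2 * (a * r + b * s)))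
    (hδ₁ : (vx ^ 2 + vy ^ 2) * δ₁ = -δ * Q₁) (hδ₂ : (a ^ 2 + b ^ 2) * δ₂ = -δ * P₂)
    (hl₁ : (vx ^ 2 + vy ^ 2) * l₁ = δ * Q₁) (hp : (a ^ 2 + b ^ 2) * p = 1) :
    l₁ * a + (δ₁ * a + δ₂ * vx) * p * a ^ 2 - δ * p ^ 2 * (2 * (a * r + b * s)) * a ^ 2
        + 2 * δ * p * a * r = 0 ∧
    l₁ * b + (δ₁ * b + δ₂ * vy) * p * a ^ 2 - δ * p ^ 2 * (2 * (a * s + b * t)) * a ^ 2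
        + 2 * δ * p * a * s
      + 2 * ((δ₁ * a + δ₂ * vx) * p * (a * b) - δ * p ^ 2 * (2 * (a * r + b * s)) * (a * b)
        + δ * p * (a * s + r * b)) = 0 ∧
    l₁ * a + (δ₁ * a + δ₂ * vx) * p * b ^ 2 - δ * p ^ 2 * (2 * (a * r + b * s)) * b ^ 2
        + 2 * δ * p * b * s
      + 2 * ((δ₁ * b + δ₂ * vy) * p * (a * b) - δ * p ^ 2 * (2 * (a * s + b * t)) * (a * b)
        + δ * p * (a * t + s * b)) = 0 ∧
    l₁ * b + (δ₁ * b + δ₂ * vy) * p * b ^ 2 - δ * p ^ 2 * (2 * (a * s + b * t)) * b ^ 2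
        + 2 * δ * p * b * t = 0 := by
  obtain ⟨k₁, k₂, k₃, k₄⟩ := log_derivatives_of_orthogonal hP hJ h hx hy hQ₁ hP₂ hδ₁ hδ₂ hl₁
  have hp : p = 1 / (a ^ 2 + b ^ 2) := by rw [eq_div_iff hP]; linear_combination hp
  rw [k₂, k₃, k₄, k₁, hp]
  refine ⟨?_, ?_, ?_, ?_⟩ <;> field_simp <;> ring

end

variable {U : Opens (ℝ × ℝ)} {u v j : Smooth U}

local notation "𝒞" => algebraMap ℂ (Smooth U)

/-- The tensor l · Id + δ ∇u ⊗ ∇u / |∇u|² has eigenvalue l + δ along ∇u and l along ∇v. The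
hypotheses on δ and l are Eisenhart's equations for the eigenvalues of a Killing tensor in
orthogonal coordinates. -/
theorem isKilling_of_stackel (hj : jacobian u v * j = 1) (hR : gradInner u v = 0)
    (hP : IsUnit (gradInner u u)) {δ l π : Smooth U} (hπ : gradInner u u * π = 1)
    (hδ₁ : gradInner v v * partialU j v δ = -δ * partialU j v (gradInner v v))
    (hδ₂ : gradInner u u * partialV j u δ = -δ * partialV j u (gradInner u u))
    (hl₁ : gradInner v v * partialU j v l = δ * partialU j v (gradInner v v))
    (hl₂ : partialV j u l = 0) :
    IsKilling (l + δ * π * Dx U u ^ 2) (δ * π * (Dx U u * Dy U u)) (l + δ * π * Dy U u ^ 2) := by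
  have hπD (D : Derivation ℂ (Smooth U) (Smooth U)) :
      D π = -π ^ 2 * D (gradInner u u) := derivation_of_mul_eq_one D hπ
  have pt : ∀ z : U, eval z (Dx U (l + δ * π * Dx U u ^ 2)) = 0 ∧
      eval z (Dy U (l + δ * π * Dx U u ^ 2) + 2 * Dx U (δ * π * (Dx U u * Dy U u))) = 0 ∧
      eval z (Dx U (l + δ * π * Dy U u ^ 2) + 2 * Dy U (δ * π * (Dx U u * Dy U u))) = 0 ∧
      eval z (Dy U (l + δ * π * Dy U u ^ 2)) = 0 := by
    intro z
    have hP0 := isUnit_iff.1 hP z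
    have hJ0 := isUnit_iff.1 (IsUnit.of_mul_eq_one _ hj) z
    have eπ := congrArg (eval z) hπ
    have eR := congrArg (eval z) hR
    have ex := congrArg (eval z) (congrArg (Dx U) hR)
    have ey := congrArg (eval z) (congrArg (Dy U) hR)
    have eQ₁ : eval z (jacobian u v * partialU j v (gradInner v v))
        = eval z (Dy U v * Dx U (gradInner v v) - Dx U v * Dy U (gradInner v v)) :=
      congrArg (eval z) (by rw [partialU_apply, ← mul_assoc, hj, one_mul])
    have eP₂ : eval z (jacobian u v * partialV j u (gradInner u u))
        = eval z (Dx U u * Dy U (gradInner u u) - Dy U u * Dx U (gradInner u u)) :=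
      congrArg (eval z) (by rw [partialV_apply, ← mul_assoc, hj, one_mul])
    have eδ₁ := congrArg (eval z) hδ₁
    have eδ₂ := congrArg (eval z) hδ₂
    have el₁ := congrArg (eval z) hl₁
    have dδx := Dx_eq hj δ
    have dδy := Dy_eq hj δ
    have dlx := Dx_eq hj l
    have dly := Dy_eq hj l
    rw [hl₂, zero_mul, add_zero] at dlx dly
    simp only [map_add, Derivation.leibniz, Derivation.leibniz_pow, smul_eq_mul, Nat.reduceSub,
      pow_one, hπD, dδx, dδy, dlx, dly, nsmul_eq_mul]
    generalize partialU j v (gradInner v v) = Q₁ at eQ₁ eδ₁ el₁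
    generalize partialV j u (gradInner u u) = P₂ at eP₂ eδ₂
    generalize partialU j v δ = δ₁ at eδ₁ ⊢
    generalize partialV j u δ = δ₂ at eδ₂ ⊢
    generalize partialU j v l = l₁ at el₁ ⊢
    simp only [gradInner, jacobian, map_add, map_sub, map_neg, map_mul, Derivation.leibniz,
      smul_eq_mul, Dx_Dy, map_zero, map_one] at eπ eR ex ey eQ₁ eP₂ eδ₁ eδ₂ el₁ hP0 hJ0
    obtain ⟨k₁, k₂, k₃, k₄⟩ := killing_equations_of_orthogonal
      (r := eval z (Dx U (Dx U u))) (s := eval z (Dy U (Dx U u))) (t := eval z (Dy U (Dy U u)))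
      (vxx := eval z (Dx U (Dx U v))) (vxy := eval z (Dy U (Dx U v)))
      (vyy := eval z (Dy U (Dy U v))) (δ := eval z δ) (p := eval z π)
      (Q₁ := eval z Q₁) (P₂ := eval z P₂) (δ₁ := eval z δ₁) (δ₂ := eval z δ₂) (l₁ := eval z l₁)
      (by rwa [sq, sq]) hJ0 eR (by linear_combination ex) (by linear_combination ey)
      (by linear_combination eQ₁) (by linear_combination eP₂) (by linear_combination eδ₁)
      (by linear_combination eδ₂) (by linear_combination el₁) (by linear_combination eπ)
    clear eπ eR ex ey eQ₁ eP₂ eδ₁ eδ₂ el₁ hP0 hJ0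
    simp only [gradInner, map_add, map_neg, map_mul, Derivation.leibniz, smul_eq_mul, Dx_Dy,
      map_pow, map_ofNat, Nat.cast_ofNat]
    refine ⟨?_, ?_, ?_, ?_⟩
    · linear_combination k₁
    · linear_combination k₂
    · linear_combination k₃
    · linear_combination k₄
  exact ⟨ext_eval fun z => (pt z).1.trans (map_zero _).symm,
    ext_eval fun z => (pt z).2.1.trans (map_zero _).symm,
    ext_eval fun z => (pt z).2.2.1.trans (map_zero _).symm,
    ext_eval fun z => (pt z).2.2.2.trans (map_zero _).symm⟩

section
variable {A : Type*} [CommRing A] {P Q π κ P₁ P₂ P₁₂ Q₁ Q₂ Q₁₂ : A}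

/-- The Stäckel condition on Q in logarithmic form: (log Q)_{uv} = (log Q)_u (log P)_v. -/
theorem mixed_log_derivative_eq_mul (hπ : P * π = 1) (hκ : Q * κ = 1)
    (h₂ : P * (Q * Q₁₂ - Q₁ * Q₂) = Q * (Q₁ * P₂)) :
    κ * Q₁₂ - κ ^ 2 * Q₂ * Q₁ = π * κ * (Q₁ * P₂) := by
  linear_combination κ ^ 2 * π * h₂
    + (-κ * Q₁₂ * (P * π) + κ * π * Q₁ * P₂) * hκ + (-κ * Q₁₂ + κ ^ 2 * Q₁ * Q₂) * hπ

/-- The mixed logarithmic derivatives of `P` and `Q` agree under the Stäckel conditions. -/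
theorem mixed_log_derivative_eq (hπ : P * π = 1) (hκ : Q * κ = 1)
    (h₁ : Q * (P * P₁₂ - P₁ * P₂) = P * (Q₁ * P₂))
    (h₂ : P * (Q * Q₁₂ - Q₁ * Q₂) = Q * (Q₁ * P₂)) :
    κ * Q₁₂ - κ ^ 2 * Q₂ * Q₁ = π * P₁₂ - π ^ 2 * P₁ * P₂ := by
  have e := mixed_log_derivative_eq_mul (P₂ := Q₁) (Q₁ := P₂) (Q₂ := P₁) (Q₁₂ := P₁₂) hκ hπ
    (by linear_combination h₁)
  linear_combination mixed_log_derivative_eq_mul hπ hκ h₂ - e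

end

/-- Since ∇u ⊥ ∇v, the form K dV is (l + δ)V_u du + l V_v dv. By the equations for δ and l, its
closedness is δ times the Stäckel condition on V. -/
theorem bertrandDarboux_of_stackel (hj : jacobian u v * j = 1) (hR : gradInner u v = 0)
    (hP : IsUnit (gradInner u u)) (hQ : IsUnit (gradInner v v)) {δ l π V : Smooth U}
    (hπ : gradInner u u * π = 1)
    (hδ₂ : gradInner u u * partialV j u δ = -δ * partialV j u (gradInner u u))
    (hl₁ : gradInner v v * partialU j v l = δ * partialU j v (gradInner v v))
    (hl₂ : partialV j u l = 0)
    (hV : gradInner u u * gradInner v v * partialV j u (partialU j v V)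
      = gradInner v v * partialV j u (gradInner u u) * partialU j v V
        + gradInner u u * partialU j v (gradInner v v) * partialV j u V) :
    BertrandDarboux (l + δ * π * Dx U u ^ 2) (δ * π * (Dx U u * Dy U u))
      (l + δ * π * Dy U u ^ 2) V := by
  have h := exterior_derivative_eq hj ((l + δ) * partialU j v V) (l * partialV j u V)
  have h0 : partialV j u ((l + δ) * partialU j v V) - partialU j v (l * partialV j u V) = 0 := by
    refine (hP.mul hQ).mul_left_cancel ?_
    simp only [map_add, Derivation.leibniz, smul_eq_mul, hl₂, ← partialV_partialU hj]
    linear_combination δ * hV + gradInner v v * partialU j v V * hδ₂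
      - gradInner u u * partialV j u V * hl₁
  rw [h0, mul_zero, sub_eq_zero] at h
  have hVx := Dx_eq hj V
  have hVy := Dy_eq hj V
  rw [gradInner] at hR hπ
  rw [BertrandDarboux, hVx, hVy]
  convert h.symm using 2
  · linear_combination δ * partialU j v V * Dy U u * hπ + δ * π * partialV j u V * Dy U u * hR
  · linear_combination δ * partialU j v V * Dx U u * hπ + δ * π * partialV j u V * Dx U u * hR

/-- The potential does not satisfy the Stäckel conditions in any orthogonal coordinates. -/
theorem not_stackel (hU : U ≤ regularPlane) (hconv : Convex ℝ (U : Set (ℝ × ℝ))) (hne : Nonempty U)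
    (hj : jacobian u v * j = 1) (hR : gradInner u v = 0)
    (hP : IsUnit (gradInner u u)) (hQ : IsUnit (gradInner v v))
    (h₁ : gradInner v v * (gradInner u u * partialV j u (partialU j v (gradInner u u))
        - partialU j v (gradInner u u) * partialV j u (gradInner u u))
      = gradInner u u * (partialU j v (gradInner v v) * partialV j u (gradInner u u)))
    (h₂ : gradInner u u * (gradInner v v * partialV j u (partialU j v (gradInner v v))
        - partialU j v (gradInner v v) * partialV j u (gradInner v v))
      = gradInner v v * (partialU j v (gradInner v v) * partialV j u (gradInner u u)))
    {α β : ℂ} (hα : α ≠ 0) {V : Smooth U}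
    (hVeq : V = 𝒞 α * (coordY U * invCbrtX hU ^ 2) + 𝒞 β * invCbrtX hU ^ 6)
    (hV : gradInner u u * gradInner v v * partialV j u (partialU j v V)
      = gradInner v v * partialV j u (gradInner u u) * partialU j v V
        + gradInner u u * partialU j v (gradInner v v) * partialV j u V) : False := by
  obtain ⟨π, hπ⟩ := hP.exists_right_inv
  obtain ⟨κ, hκ⟩ := hQ.exists_right_inv
  -- F = log δ with F_u = -(log Q)_u and F_v = -(log P)_v, integrable because the mixed logarithmic
  -- derivatives of P and Q agree. Exponentiating makes δ nowhere zero.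
  obtain ⟨F, hF₁, hF₂⟩ := exists_primitive_coord hj hconv
    (g := -κ * partialU j v (gradInner v v)) (h := -π * partialV j u (gradInner u u)) (by
      simp only [Derivation.leibniz, map_neg, smul_eq_mul, derivation_of_mul_eq_one _ hπ,
        derivation_of_mul_eq_one _ hκ,
        ← partialV_partialU hj]
      linear_combination -mixed_log_derivative_eq hπ hκ h₁ h₂)
  obtain ⟨δ, hδ0, hδ⟩ := exists_exp F
  have hδu : ∀ z, eval z δ ≠ 0 := hδ0
  have hδ₁ : partialU j v δ = δ * partialU j v F := by
    rw [partialU_apply, partialU_apply, hδ, hδ]; ring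
  have hδ₂ : partialV j u δ = δ * partialV j u F := by
    rw [partialV_apply, partialV_apply, hδ, hδ]; ring
  rw [hF₁] at hδ₁
  rw [hF₂] at hδ₂
  -- Integrability of l_u = δ (log Q)_u, l_v = 0 amounts to (log Q)_{uv} = (log P)_v (log Q)_u.
  obtain ⟨l, hl₁, hl₂⟩ := exists_primitive_coord hj hconv
    (g := δ * κ * partialU j v (gradInner v v)) (h := 0) (by
      rw [map_zero]
      simp only [Derivation.leibniz, smul_eq_mul, derivation_of_mul_eq_one _ hκ, hδ₂]
      linear_combination δ * mixed_log_derivative_eq_mul hπ hκ h₂)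
  have e₁ : gradInner v v * partialU j v δ = -δ * partialU j v (gradInner v v) := by
    rw [hδ₁]; linear_combination -δ * partialU j v (gradInner v v) * hκ
  have e₂ : gradInner u u * partialV j u δ = -δ * partialV j u (gradInner u u) := by
    rw [hδ₂]; linear_combination -δ * partialV j u (gradInner u u) * hπ
  have e₃ : gradInner v v * partialU j v l = δ * partialU j v (gradInner v v) := by
    rw [hl₁]; linear_combination δ * partialU j v (gradInner v v) * hκ
  have hK := isKilling_of_stackel hj hR hP hπ e₁ e₂ e₃ hl₂
  have hBD := bertrandDarboux_of_stackel hj hR hP hQ hπ e₂ e₃ hl₂ hV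
  obtain ⟨a, b₁, b₂, c₁, c₂, c, hK₁₁, hK₁₂, hK₂₂⟩ := hK.exists_polynomial hconv
  rw [hK₁₁, hK₁₂, hK₂₂, hVeq] at hBD
  obtain ⟨rfl, rfl, rfl, rfl, rfl⟩ := bertrandDarboux_rigid hU hne hα hBD
  obtain ⟨z⟩ := hne
  have k₁ := congrArg (eval z) (hK₁₁.trans (c := 𝒞 c₁) (by rw [map_zero]; ring))
  have k₂ := congrArg (eval z) (hK₁₂.trans (c := 0) (by rw [map_zero]; ring))
  have k₃ := congrArg (eval z) (hK₂₂.trans (c := 𝒞 c₁) (by rw [map_zero]; ring))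
  have kπ := congrArg (eval z) hπ
  have hP0 := isUnit_iff.1 hP z
  simp only [gradInner, map_add, map_mul, map_pow, map_zero, map_one] at k₁ k₂ k₃ kπ hP0
  have hd := hδu z
  have hp : eval z π ≠ 0 := right_ne_zero_of_mul (kπ.trans_ne one_ne_zero)
  have m₁ : eval z (Dx U u) ^ 2 - eval z (Dy U u) ^ 2 = 0 :=
    mul_left_cancel₀ (mul_ne_zero hd hp) (by linear_combination k₁ - k₃)
  have m₂ : eval z (Dx U u) * eval z (Dy U u) = 0 :=
    mul_left_cancel₀ (mul_ne_zero hd hp) (by linear_combination k₂)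
  -- K is scalar and δ ≠ 0, so u_x² = u_y² and u_x u_y = 0; then |∇u|⁴ = (u_x² - u_y²)² + 4(u_x
  -- u_y)² = 0.
  refine hP0 (pow_eq_zero_iff (two_ne_zero) |>.1 ?_)
  linear_combination (eval z (Dx U u) ^ 2 - eval z (Dy U u) ^ 2) * m₁
    + 4 * (eval z (Dx U u) * eval z (Dy U u)) * m₂

end QuantumPlane
end

/-! ### Complete separated solutions and the contradiction -/

noncomputable section
namespace QuantumPlane
open Smooth

/-- The restriction of smooth functions to a smaller open set. -/
def Smooth.res {W U : Opens (ℝ × ℝ)} (h : U ≤ W) : Smooth W →ₐ[ℂ] Smooth U where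
  toFun f := restrict U (extendZero f.1) (f.2.mono h)
  map_one' := ext_apply fun z => by simp [extendZero_of_mem _ (h z.2)]
  map_mul' f g := ext_apply fun z => by simp [extendZero_of_mem _ (h z.2)]
  map_zero' := ext_apply fun z => by simp [extendZero_of_mem _ (h z.2)]
  map_add' f g := ext_apply fun z => by simp [extendZero_of_mem _ (h z.2)]
  commutes' c := ext_apply fun z => by simp [extendZero_of_mem _ (h z.2)]

section Restriction
variable {W U : Opens (ℝ × ℝ)} (h : U ≤ W)

theorem Smooth.res_apply (f : Smooth W) (z : U) : (res h f).1 z = f.1 ⟨z, h z.2⟩ :=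
  extendZero_of_mem _ (h z.2)

theorem Smooth.derivation_res (v : ℝ × ℝ) (f : Smooth W) :
    derivation U v (res h f) = res h (derivation W v f) := by
  refine ext_apply fun z => ?_
  rw [res_apply, ← dirDeriv_eq_derivation, ← dirDeriv_eq_derivation]
  exact (dirDeriv_restrict v _ (f.2.mono h) z).trans (coe_dirDeriv v f ⟨z, h z.2⟩).symm

theorem Smooth.res_coordY : res h (coordY W) = coordY U := ext_apply fun z => res_apply h _ z

theorem Smooth.res_invCbrtX (hW : W ≤ regularPlane) :
    res h (invCbrtX hW) = invCbrtX (h.trans hW) := ext_apply fun z => res_apply h _ z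

end Restriction

section Pullback
variable {U : Opens (ℝ × ℝ)}

/-- The pullbacks of the derivatives of a function of one variable along a smooth function. -/
theorem exists_pullback {u : ℝ × ℝ → ℝ} (hu : ContDiffOn ℝ ∞ u U) {I : Set ℝ} (hI : IsOpen I)
    {g : ℝ → ℂ} (hg : ContDiffOn ℝ ∞ g I) (hmaps : ∀ z ∈ U, u z ∈ I) :
    ∃ G : ℕ → Smooth U, (∀ n z, (G n).1 z = iteratedDeriv n g (u z)) ∧
      ∀ n v, derivation U v (G n) = G (n + 1) * derivation U v (ofReal U u hu) := by
  have hd : ∀ n, ContDiffOn ℝ ∞ (iteratedDeriv n g) I := by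
    intro n
    induction n with
    | zero => simpa using hg
    | succ n ih =>
      rw [iteratedDeriv_succ]
      exact ih.deriv_of_isOpen hI (by simp)
  refine ⟨fun n => restrict U (fun z => iteratedDeriv n g (u z)) ((hd n).comp hu hmaps),
    fun n z => rfl, fun n v => ext_apply fun z => ?_⟩
  have h1 : HasDerivAt (iteratedDeriv n g) (iteratedDeriv (n + 1) g (u z)) (u z) := by
    rw [iteratedDeriv_succ]
    exact (((hd n).contDiffAt (hI.mem_nhds (hmaps z z.2))).differentiableAt (by simp)).hasDerivAt
  have h2 : HasFDerivAt u (fderiv ℝ u z) z :=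
    ((hu.contDiffAt (U.isOpen.mem_nhds z.2)).differentiableAt (by simp)).hasFDerivAt
  have h3 := h1.hasFDerivAt.comp z.1 h2
  rw [← dirDeriv_eq_derivation, dirDeriv_restrict]
  refine (congrArg (fun L : ℝ × ℝ →L[ℝ] ℂ => L v) h3.fderiv).trans ?_
  refine Eq.trans ?_ (congrArg (fun c => iteratedDeriv (n + 1) g (u z) * c)
    (derivation_ofReal v u hu z h2)).symm
  simp [mul_comm]

/-- The Laplacian. -/
def laplacian (f : Smooth U) : Smooth U := Dx U (Dx U f) + Dy U (Dy U f)

local notation "𝒞" => algebraMap ℂ (Smooth U)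

theorem laplacian_mul_of_pullback {u v : Smooth U} {G K : ℕ → Smooth U}
    (hG : ∀ n t, derivation U t (G n) = G (n + 1) * derivation U t u)
    (hK : ∀ n t, derivation U t (K n) = K (n + 1) * derivation U t v) :
    laplacian (G 0 * K 0) = gradInner u u * G 2 * K 0 + 2 * gradInner u v * G 1 * K 1
      + gradInner v v * G 0 * K 2 + laplacian u * G 1 * K 0 + laplacian v * G 0 * K 1 := by
  simp only [laplacian, gradInner, map_add, Derivation.leibniz, smul_eq_mul, hG, hK]
  ring

/-- `G n` and `K n` stand for the n-th derivatives of A and B composed with u and v. Dividing the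
Schrödinger equation by m A B puts it in the form required by `leviCivita_eq_zero`. -/
theorem leviCivita_of_separated {u v j : Smooth U} (hj : jacobian u v * j = 1)
    {G K : ℕ → Smooth U} (hG : ∀ n t, derivation U t (G n) = G (n + 1) * derivation U t u)
    (hK : ∀ n t, derivation U t (K n) = K (n + 1) * derivation U t v)
    {ι κ : Smooth U} (hι : G 0 * ι = 1) (hκ : K 0 * κ = 1) {V : Smooth U} {m E : ℂ} (hm : m ≠ 0)
    (h : m • laplacian (G 0 * K 0) + V * (G 0 * K 0) = E • (G 0 * K 0)) :
    leviCivita (mixedJet (partialU j v) (partialV j u) (gradInner u u))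
      (mixedJet (partialU j v) (partialV j u) (gradInner u v))
      (mixedJet (partialU j v) (partialV j u) (gradInner v v))
      (mixedJet (partialU j v) (partialV j u) (laplacian u))
      (mixedJet (partialU j v) (partialV j u) (laplacian v))
      (mixedJet (partialU j v) (partialV j u) (𝒞 m⁻¹ * V))
      (G 1 * ι) (G 2 * ι) (K 1 * κ) (K 2 * κ) = 0 := by
  have hUG : ∀ n, partialU j v (G n) = G (n + 1) := fun n => by
    have := partialU_u hj
    rw [partialU_apply] at this ⊢
    rw [hG, hG]; linear_combination G (n + 1) * this
  have hVG : ∀ n, partialV j u (G n) = 0 := fun n => by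
    rw [partialV_apply, hG, hG]; ring
  have hUK : ∀ n, partialU j v (K n) = 0 := fun n => by
    rw [partialU_apply, hK, hK]; ring
  have hVK : ∀ n, partialV j u (K n) = K (n + 1) := fun n => by
    have := partialV_v hj
    rw [partialV_apply] at this ⊢
    rw [hK, hK]; linear_combination K (n + 1) * this
  have hUι : partialU j v ι = -ι ^ 2 * G 1 := by rw [derivation_of_mul_eq_one _ hι, hUG]
  have hVι : partialV j u ι = 0 := by rw [derivation_of_mul_eq_one _ hι, hVG, mul_zero]
  have hUκ : partialU j v κ = 0 := by rw [derivation_of_mul_eq_one _ hκ, hUK, mul_zero]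
  have hVκ : partialV j u κ = -κ ^ 2 * K 1 := by rw [derivation_of_mul_eq_one _ hκ, hVK]
  have hmm : 𝒞 m⁻¹ * 𝒞 m = 1 := by rw [← map_mul, inv_mul_cancel₀ hm, map_one]
  -- Here a₃ is the derivative of A''/A, namely A'''/A - A'A''/A², and similarly for b₃.
  refine leviCivita_eq_zero (E := m⁻¹ * E) (a₃ := G 3 * ι - G 1 * G 2 * ι ^ 2)
    (b₃ := K 3 * κ - K 1 * K 2 * κ ^ 2) ?_ ?_ ?_ ?_ ?_ ?_ ?_ ?_ ?_ ?_
  · rw [laplacian_mul_of_pullback hG hK, Algebra.smul_def, Algebra.smul_def] at h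
    have hικ : G 0 * K 0 * (ι * κ) = 1 := by linear_combination hκ + K 0 * κ * hι
    have h' : 𝒞 m⁻¹ * (ι * κ) * (𝒞 m * (gradInner u u * G 2 * K 0
          + 2 * gradInner u v * G 1 * K 1 + gradInner v v * G 0 * K 2
          + laplacian u * G 1 * K 0 + laplacian v * G 0 * K 1) + V * (G 0 * K 0))
        = 𝒞 m⁻¹ * 𝒞 E := by
      linear_combination 𝒞 m⁻¹ * (ι * κ) * h + 𝒞 m⁻¹ * 𝒞 E * hικ
    rw [map_mul, ← h']
    linear_combination -𝒞 m⁻¹ * V * hικ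
      - (ι * κ) * (gradInner u u * G 2 * K 0
          + 2 * gradInner u v * G 1 * K 1 + gradInner v v * G 0 * K 2
          + laplacian u * G 1 * K 0 + laplacian v * G 0 * K 1) * hmm
      - (gradInner u u * G 2 * ι + laplacian u * G 1 * ι) * hκ
      - (gradInner v v * K 2 * κ + laplacian v * K 1 * κ) * hι
  all_goals
    simp only [map_sub, Derivation.leibniz, Derivation.leibniz_pow, smul_eq_mul, hUG, hVG, hUK,
      hVK, hUι, hVι, hUκ, hVκ, smul_zero, mul_zero, add_zero, sub_zero]
  all_goals ring

end Pullback

theorem leviCivita_eq_zero_of_jacobian {C : Set (Fin 4 → ℝ)} (hC : IsOpen C) (hne : C.Nonempty)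
    (F : (Fin 4 → ℝ) → Fin 4 → ℂ)
    (hdet : ∀ c ∈ C, (Matrix.of fun i j : Fin 4 =>
      fderiv ℝ (fun c' => F c' i) c (Pi.single j 1)).det ≠ 0)
    {P R Q p q w : Fin 4 → ℂ}
    (h : ∀ c ∈ C, leviCivita P R Q p q w (F c 0) (F c 1) (F c 2) (F c 3) = 0)
    (a₁ a₂ b₁ b₂ : ℂ) : leviCivita P R Q p q w a₁ a₂ b₁ b₂ = 0 := by
  let poly : MvPolynomial (Fin 4) ℂ := leviCivita (MvPolynomial.C ∘ P) (MvPolynomial.C ∘ R)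
    (MvPolynomial.C ∘ Q) (MvPolynomial.C ∘ p) (MvPolynomial.C ∘ q) (MvPolynomial.C ∘ w)
    (MvPolynomial.X 0) (MvPolynomial.X 1) (MvPolynomial.X 2) (MvPolynomial.X 3)
  have hev : ∀ x : Fin 4 → ℂ, MvPolynomial.eval x poly
      = leviCivita P R Q p q w (x 0) (x 1) (x 2) (x 3) := fun x => by
    have hc : ∀ f : Fin 4 → ℂ, MvPolynomial.eval x ∘ (MvPolynomial.C ∘ f) = f :=
      fun f => funext fun i => MvPolynomial.eval_C _
    rw [map_leviCivita]
    simp only [hc, MvPolynomial.eval_X]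
  have h0 : poly = 0 := eq_zero_of_eval_eq_zero hC hne F hdet poly
    fun c hc => (hev _).trans (h c hc)
  have := hev ![a₁, a₂, b₁, b₂]
  rw [h0, map_zero] at this
  exact this.symm

section CoordinateSystem

variable {W : Opens (ℝ × ℝ)} {φ : OpenPartialHomeomorph (ℝ × ℝ) (ℝ × ℝ)}

theorem IsCoordinateSystem.jacobian_ne_zero (h : IsCoordinateSystem W φ) {z : ℝ × ℝ} (hz : z ∈ W) :
    fderiv ℝ (fun z => (φ z).1) z (1, 0) * fderiv ℝ (fun z => (φ z).2) z (0, 1)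
      - fderiv ℝ (fun z => (φ z).1) z (0, 1) * fderiv ℝ (fun z => (φ z).2) z (1, 0) ≠ 0 := by
  have hs : z ∈ φ.source := by rw [h.source_eq]; exact hz
  have d1 : DifferentiableAt ℝ φ z :=
    (h.smooth.contDiffAt (φ.open_source.mem_nhds hs)).differentiableAt (by simp)
  have d2 : DifferentiableAt ℝ φ.symm (φ z) :=
    (h.smooth_symm.contDiffAt (φ.open_target.mem_nhds (φ.map_source hs))).differentiableAt (by simp)
  have hcomp := d2.hasFDerivAt.comp z d1.hasFDerivAt
  have hid : HasFDerivAt (φ.symm ∘ φ) (ContinuousLinearMap.id ℝ (ℝ × ℝ)) z :=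
    (hasFDerivAt_id z).congr_of_eventuallyEq
      (Filter.eventually_of_mem (φ.open_source.mem_nhds hs) fun y hy => φ.left_inv hy)
  have hL := hcomp.unique hid
  have hinj : ∀ t, fderiv ℝ φ z t = 0 → t = 0 := fun t ht => by
    have := congrArg (fun L : ℝ × ℝ →L[ℝ] ℝ × ℝ => L t) hL
    simpa [ht] using this.symm
  have e1 : fderiv ℝ (fun z => (φ z).1) z = (ContinuousLinearMap.fst ℝ ℝ ℝ).comp (fderiv ℝ φ z) :=
    d1.hasFDerivAt.fst.fderiv
  have e2 : fderiv ℝ (fun z => (φ z).2) z = (ContinuousLinearMap.snd ℝ ℝ ℝ).comp (fderiv ℝ φ z) :=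
    d1.hasFDerivAt.snd.fderiv
  rw [e1, e2]
  simp only [ContinuousLinearMap.comp_apply, ContinuousLinearMap.coe_fst',
    ContinuousLinearMap.coe_snd']
  intro hdet
  have hlin : ∀ a b : ℝ, fderiv ℝ φ z (a, b)
      = a • fderiv ℝ φ z (1, 0) + b • fderiv ℝ φ z (0, 1) := fun a b => by
    rw [← map_smul, ← map_smul, ← map_add]; simp
  generalize fderiv ℝ φ z (1, 0) = s at *
  generalize fderiv ℝ φ z (0, 1) = t at *
  -- If the determinant vanished, the cofactor vectors would lie in the kernel of the injective
  -- derivative, hence be zero; then the whole matrix would be zero.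
  have k1 := hinj (t.2, -s.2) (by
    rw [hlin]; ext <;> simp <;> [linear_combination hdet; ring])
  have k2 := hinj (t.1, -s.1) (by
    rw [hlin]; ext <;> simp <;> [ring; linear_combination -hdet])
  simp only [Prod.mk_eq_zero, neg_eq_zero] at k1 k2
  have := hinj (1, 0) (by rw [hlin]; ext <;> simp [k1, k2])
  simp at this

/-- The Schrödinger equation does not separate in any coordinate system. -/
theorem not_separatesIn {ħ α : ℝ} (hħ : 0 < ħ) (hα : α ≠ 0) (hW : W ≤ regularPlane)
    (hne : (W : Set (ℝ × ℝ)).Nonempty) (hφ : IsCoordinateSystem W φ)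
    (hV : ContDiffOn ℝ ∞ (potential ħ α) W) : ¬ SeparatesIn ħ (potential ħ α) W hV φ := by
  rintro ⟨C, A, B, E, hC, hCne, hA, hB, hsep⟩
  obtain ⟨z₀, hz₀⟩ := hne
  -- Passing to a ball supplies the convexity that the primitives need.
  obtain ⟨r, hr, hball⟩ := Metric.isOpen_iff.1 W.isOpen z₀ hz₀
  let U : Opens (ℝ × ℝ) := ⟨Metric.ball z₀ r, Metric.isOpen_ball⟩
  have hUW : U ≤ W := hball
  have hU : U ≤ regularPlane := hUW.trans hW
  have hconv : Convex ℝ (U : Set (ℝ × ℝ)) := convex_ball _ _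
  have hUne : Nonempty U := ⟨⟨z₀, Metric.mem_ball_self hr⟩⟩
  have hsrc : ∀ {z}, z ∈ U → z ∈ φ.source := fun hz => by rw [hφ.source_eq]; exact hUW hz
  have hφU : ContDiffOn ℝ ∞ φ U := hφ.smooth.mono fun z hz => hsrc hz
  have hu : ContDiffOn ℝ ∞ (fun z => (φ z).1) U := hφU.fst
  have hv : ContDiffOn ℝ ∞ (fun z => (φ z).2) U := hφU.snd
  set u := ofReal U _ hu with hu_def
  set v := ofReal U _ hv with hv_def
  have hdu : ∀ (t : ℝ × ℝ) (z : U), eval z (derivation U t u)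
      = (fderiv ℝ (fun z => (φ z).1) z t : ℂ) := fun t z =>
    derivation_ofReal t _ hu z
      ((hu.contDiffAt (U.isOpen.mem_nhds z.2)).differentiableAt (by simp)).hasFDerivAt
  have hdv : ∀ (t : ℝ × ℝ) (z : U), eval z (derivation U t v)
      = (fderiv ℝ (fun z => (φ z).2) z t : ℂ) := fun t z =>
    derivation_ofReal t _ hv z
      ((hv.contDiffAt (U.isOpen.mem_nhds z.2)).differentiableAt (by simp)).hasFDerivAt
  have hJ : IsUnit (jacobian u v) := isUnit_iff.2 fun z => by
    simp only [jacobian, map_sub, map_mul, hdu, hdv]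
    exact_mod_cast hφ.jacobian_ne_zero (hUW z.2)
  have hP : IsUnit (gradInner u u) := isUnit_iff.2 fun z hz => by
    apply hφ.jacobian_ne_zero (hUW z.2)
    simp only [gradInner, map_add, map_mul, hdu] at hz
    norm_cast at hz
    -- The coordinates are real, so a vanishing sum of squares forces the gradient to vanish;
    -- complex coordinates could be isotropic.
    rw [mul_self_add_mul_self_eq_zero] at hz
    rw [hz.1, hz.2, zero_mul, zero_mul, sub_zero]
  have hQ : IsUnit (gradInner v v) := isUnit_iff.2 fun z hz => by
    apply hφ.jacobian_ne_zero (hUW z.2)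
    simp only [gradInner, map_add, map_mul, hdv] at hz
    norm_cast at hz
    rw [mul_self_add_mul_self_eq_zero] at hz
    rw [hz.1, hz.2, mul_zero, mul_zero, sub_zero]
  obtain ⟨j, hj⟩ := hJ.exists_right_inv
  set k : ℂ := -Complex.I * ħ with hk
  set m : ℂ := k ^ 2 / 2 with hm_def
  have hm : m ≠ 0 := div_ne_zero (pow_ne_zero 2 (neg_I_mul_ne_zero hħ)) two_ne_zero
  set V : Smooth U := (α : ℂ) • (coordY U * invCbrtX hU ^ 2)
    + (5 * k ^ 2 / 72) • invCbrtX hU ^ 6 with hV_def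
  have hlc : ∀ (z : U) (a₁ a₂ b₁ b₂ : ℂ),
      leviCivita (eval z ∘ mixedJet (partialU j v) (partialV j u) (gradInner u u))
        (eval z ∘ mixedJet (partialU j v) (partialV j u) (gradInner u v))
        (eval z ∘ mixedJet (partialU j v) (partialV j u) (gradInner v v))
        (eval z ∘ mixedJet (partialU j v) (partialV j u) (laplacian u))
        (eval z ∘ mixedJet (partialU j v) (partialV j u) (laplacian v))
        (eval z ∘ mixedJet (partialU j v) (partialV j u) (algebraMap ℂ (Smooth U) m⁻¹ * V))
        a₁ a₂ b₁ b₂ = 0 := by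
    intro z
    -- The point z is fixed and c varies: the coefficients of the Levi-Civita expression depend only
    -- on z, and its arguments A'/A, A''/A, B'/B, B''/B vary with c.
    refine leviCivita_eq_zero_of_jacobian hC hCne (logJet A B (φ z).1 (φ z).2)
      (fun c hc => (hsep c hc).2 z (hUW z.2)) fun c hc => ?_
    obtain ⟨Ψ, hΨ, hH⟩ := (hsep c hc).1
    have hpair : ContDiff ℝ ∞ fun s : ℝ => (s, c) := contDiff_id.prodMk contDiff_const
    obtain ⟨G, hG0, hG⟩ := exists_pullback hu (isOpenMap_fst _ φ.open_target)
      (g := fun s => A s c) (hA.comp hpair.contDiffOn fun s hs => ⟨hs, hc⟩)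
      fun z hz => ⟨φ z, φ.map_source (hsrc hz), rfl⟩
    obtain ⟨K, hK0, hK⟩ := exists_pullback hv (isOpenMap_snd _ φ.open_target)
      (g := fun s => B s c) (hB.comp hpair.contDiffOn fun s hs => ⟨hs, hc⟩)
      fun z hz => ⟨φ z, φ.map_source (hsrc hz), rfl⟩
    have hΨU : res hUW Ψ = G 0 * K 0 := ext_apply fun z => by
      rw [res_apply, (hΨ _).1]
      exact (congrArg₂ (· * ·) (hG0 0 z) (hK0 0 z)).symm
    have hGK : ∀ z : U, eval z (G 0) ≠ 0 ∧ eval z (K 0) ≠ 0 := fun z => by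
      rw [← mul_ne_zero_iff, ← map_mul, ← hΨU, eval_apply, res_apply]
      exact (hΨ _).2
    obtain ⟨ι, hι⟩ := (isUnit_iff.2 fun z => (hGK z).1).exists_right_inv
    obtain ⟨κ, hκ⟩ := (isUnit_iff.2 fun z => (hGK z).2).exists_right_inv
    have hev : ∀ {f g : Smooth U} (n : Smooth U), f * g = 1 →
        eval z (n * g) = eval z n / eval z f := fun {f g} n hfg => by
      have h1 : eval z f * eval z g = 1 := by rw [← map_mul, hfg, map_one]
      rw [map_mul, eq_div_iff (left_ne_zero_of_mul (h1.trans_ne one_ne_zero))]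
      linear_combination eval z n * h1
    have hSch : m • laplacian (G 0 * K 0) + V * (G 0 * K 0) = E c • (G 0 * K 0) := by
      have h := congrArg (res hUW) hH
      rw [hamiltonian_apply hW] at h
      simp only [formH, map_add, map_mul, map_pow, map_smul, res_coordY, res_invCbrtX,
        ← derivation_res, hΨU] at h
      exact h
    have key := congrArg (eval z) (leviCivita_of_separated hj hG hK hι hκ hm hSch)
    rw [map_leviCivita, map_zero, hev _ hι, hev _ hι, hev _ hκ, hev _ hκ] at key
    simp only [eval_apply, hG0, hK0, iteratedDeriv_one, iteratedDeriv_zero] at key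
    exact key
  have hR : gradInner u v = 0 := ext_eval fun z =>
    (mixed_coeff_eq_zero (hlc z) (isUnit_iff.1 hP z) (isUnit_iff.1 hQ z)).trans (map_zero _).symm
  have hR0 : mixedJet (partialU j v) (partialV j u) (gradInner u v) = 0 := by
    rw [hR]
    ext i
    fin_cases i <;> simp [mixedJet]
  have hst := fun z : U => stackel_of_leviCivita (P := _) (Q := _) (p := _) (q := _) (w := _)
    (by
      have := hlc z
      rw [hR0] at this
      have h0 : eval z ∘ (0 : Fin 4 → Smooth U) = 0 := funext fun i => map_zero (eval z)
      rwa [h0] at this)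
  refine not_stackel hU hconv hUne hj hR hP hQ (α := α) (β := 5 * k ^ 2 / 72) (V := V)
    (ext_eval fun z => ?_) (ext_eval fun z => ?_) (by exact_mod_cast hα)
    (by rw [hV_def, Algebra.smul_def, Algebra.smul_def]) ?_
  · simpa [mixedJet] using (hst z).1
  · simpa [mixedJet] using (hst z).2.1
  -- The condition was obtained for w = V/m; it is linear in w, so the constant factor cancels.
  · refine (IsUnit.map (algebraMap ℂ (Smooth U)) (inv_ne_zero hm).isUnit).mul_left_cancel
      (ext_eval fun z => ?_)
    have h := (hst z).2.2
    simp only [mixedJet, Function.comp_apply, Matrix.cons_val, Derivation.leibniz, smul_eq_mul,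
      Derivation.map_algebraMap, mul_zero, add_zero] at h
    simp only [← map_mul, ← map_add] at h
    refine Eq.trans ?_ (h.trans ?_)
    · congr 1; ring
    · congr 1; ring

end CoordinateSystem

end QuantumPlane
end

theorem theorem18 (ħ α : ℝ) (hħ : 0 < ħ) (hα : α ≠ 0) :
    QuantumPlane.HasOrder (QuantumPlane.opX ħ α) 3 ∧
    QuantumPlane.HasOrder (QuantumPlane.opY ħ α) 4 ∧
    QuantumPlane.IsSuperintegrable
      ![QuantumPlane.opH ħ α, QuantumPlane.opX ħ α, QuantumPlane.opY ħ α] ∧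
    ∀ (W : TopologicalSpace.Opens (ℝ × ℝ)) (hW : W ≤ QuantumPlane.regularPlane)
      (φ : OpenPartialHomeomorph (ℝ × ℝ) (ℝ × ℝ)),
      (W : Set (ℝ × ℝ)).Nonempty → QuantumPlane.IsCoordinateSystem W φ →
      ¬ QuantumPlane.SeparatesIn ħ (QuantumPlane.potential ħ α) W
          ((QuantumPlane.smooth_potential ħ α).mono hW) φ :=
  ⟨QuantumPlane.opX_hasOrder hħ α, QuantumPlane.opY_hasOrder hħ α,
    QuantumPlane.isSuperintegrable_ops hħ hα,
    fun _ hW _ hne hφ => QuantumPlane.not_separatesIn hħ hα hW hne hφ _⟩
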